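/- **Setting.** Let $q\in\mathbb C^*$ be not a root of unity, $q^{1/2}$ a square root of $q$, $b(x)=x-x^{-1}$, $[X,Y]_q=qXY-q^{-1}YX$, $[n]_q=\frac{q^n-q^{-n}}{q-q^{-1}}$, $2s\in\mathbb Z_{\ge 0}$, and let $\mathtt b,\mathtt c,\mathtt b^*,\mathtt c^*,\zeta,\chi\in\mathbb C^*$ with $\mathtt b\mathtt c=\mathtt b^*\mathtt c^*$. Put $\theta_M=\mathtt bq^{2M}+\mathtt cq^{-2M}$, $\theta^*_N=\mathtt b^*q^{2N}+\mathtt c^*q^{-2N}$, $z=\zeta^2+\zeta^{-2}$, $t=\mathtt bq^{2s}+\mathtt cq^{-2s}$, $t^*=\mathtt b^*q^{2s}+\mathtt c^*q^{-2s}$, $d=q^{2s+1}+q^{-2s-1}$ and $$\rho=-\mathtt b\mathtt c(q^2-q^{-2})^2,\quad \omega=(q-q^{-1})^2(\mathtt b\mathtt c\,zd-tt^*),\quad \eta=-\tfrac{(q^2-q^{-2})^2}{q+q^{-1}}\mathtt b\mathtt c\,(tz-t^*d),\quad \eta^*=-\tfrac{(q^2-q^{-2})^2}{q+q^{-1}}\mathtt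 b^*\mathtt c^*(t^*z-td).$$ The Askey–Wilson algebra is the unital algebra generated by $A,A^*$ with relations $[A,[A,A^*]_q]_{q^{-1}}=\rho A^*+\omega A+\eta$ and $[A^*,[A^*,A]_q]_{q^{-1}}=\rho A+\omega A^*+\eta^*$. Let $\pi$ be an irreducible representation of it on a complex vector space $V$ of dimension $2s+1$ such that $\pi(A)$ has an eigenbasis $|\theta_0\rangle,\dots,|\theta_{2s}\rangle$ with pairwise distinct eigenvalues $\theta_0,\dots,\theta_{2s}$, and $\pi(A^*)$ has an eigenbasis $|\theta^*_0\rangle,\dots,|\theta^*_{2s}\rangle$ with pairwise distinct eigenvalues $\theta^*_0,\dots,\theta^*_{2s}$. Let $A_{k,k-1}$ be the coefficient of $|\theta^*_k\rangle$ in $\pi(A)|\theta^*_{k-1}\rangle$, $A^*_{k,k-1}$ the coefficient of $|\theta_k\rangle$ in $\pi(A^*)|\theta_{k-1}\rangle$, and $P$ the transition matrix, $|\theta^*_N\rangle=\sum_MP_{MN}|\theta_M\rangle$. **Bethe states.** Let $\bar\eta(u)=(q+q^{-1})\rho^{-1}(\eta u+\eta^*u^{-1})$ and $$K_{11}(u)=b(u^2)(quA-q^{-1}u^{-1}A^*)-\bar\eta(u),\qquad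 K_{22}(u)=b(u^2)(quA^*-q^{-1}u^{-1}A)-\bar\eta(u^{-1}),$$ $$K_{12}(u)=\chi b(u^2)\Big(\rho^{-1}\big([A^*,A]_q+\tfrac{\omega}{q-q^{-1}}\big)+\tfrac{qu^2+q^{-1}u^{-2}}{q^2-q^{-2}}\Big),\quad K_{21}(u)=\rho\chi^{-1} b(u^2)\Big(\rho^{-1}\big([A,A^*]_q+\tfrac{\omega}{q-q^{-1}}\big)+\tfrac{qu^2+q^{-1}u^{-2}}{q^2-q^{-2}}\Big).$$ For $\epsilon=\pm1$ and gauge parameters $\alpha,\beta$ let $\gamma^+(u,m)=\beta q^{-m}u-\alpha q^mu^{-1}$, $\gamma^-(u,m)=\alpha q^{-m}u-\beta q^mu^{-1}$, $y(u)=\beta q^{-\epsilon m}u^{-\epsilon}$, and define the dynamical operator $$\mathscr B^\epsilon(u,m)=\frac{-\epsilon(qu)^{-\epsilon}}{\gamma^\epsilon(1,m+1)}\big(y(u)K_{11}(u)+K_{12}(u)-y(u^{-1})y(u)K_{21}(u)-y(u^{-1})K_{22}(u)\big).$$ Let $m_0\in\mathbb Z$. The Bethe states of length $2s$ are $$|\Psi^{2s}_\epsilon(\bar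 u,m_0)\rangle=\pi\big(\mathscr B^\epsilon(u_1,m_0+2(2s-1))\cdots\mathscr B^\epsilon(u_{2s},m_0)\big)|\Omega^\epsilon\rangle,$$ where $\Omega^+=|\theta^*_0\rangle$, $\Omega^-=|\theta_0\rangle$, $\beta=0$, and $\alpha$ is given by $(q^2-q^{-2})\chi^{-1}\alpha\,\mathtt c^*q^{m_0}=1$ for $\epsilon=+$ and by $(q^2-q^{-2})\chi^{-1}\alpha\,\mathtt bq^{-m_0}=-1$ for $\epsilon=-$. **Inhomogeneous Bethe equations.** Let $f(u,v)=\frac{b(qv/u)b(uv)}{b(v/u)b(quv)}$, $h(u,v)=\frac{b(q^2uv)b(qu/v)}{b(quv)b(u/v)}$, $\nu_+=q^{-1-4s}\mathtt c^*$, $\nu_-=q^{1+4s}\mathtt b$, $$\Lambda^\epsilon_1(u)=\tfrac{q^{-2s-1}}{u^\epsilon}(q^{2s+1}u\zeta^{-1}-u^{-1}\zeta)(q^{2s+1}u\zeta-u^{-1}\zeta^{-1})(u\mathtt c^*q^{-2s}+u^{-1}\mathtt bq^{2s})\Big(u\big(\tfrac{\mathtt c}{\mathtt c^*}\big)^{\frac{1-\epsilon}2}+u^{-1}\big(\tfrac{\mathtt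 b^*}{\mathtt b}\big)^{\frac{1+\epsilon}2}\Big),$$ $$\Lambda^\epsilon_2(u)=\tfrac{b(u^2)q^{-2s-1}}{u^\epsilon b(qu^2)}(q^{2s-1}u^{-1}\zeta-u\zeta^{-1})(q^{2s-1}u^{-1}\zeta^{-1}-u\zeta)(q^2u\mathtt bq^{2s}+u^{-1}\mathtt c^*q^{-2s})\Big(q^2u\big(\tfrac{\mathtt b^*}{\mathtt b}\big)^{\frac{1+\epsilon}2}+u^{-1}\big(\tfrac{\mathtt c}{\mathtt c^*}\big)^{\frac{1-\epsilon}2}\Big),$$ and for $\bar u=(u_1,\dots,u_{2s})$, $1\le i\le 2s$, $$E_{\pm}(u_i,\bar u_i)=\frac{b(u_i^2)}{b(qu_i^2)}u_i^{\pm1}\prod_{j\ne i}f(u_i,u_j)\Lambda_1^{\pm}(u_i)-(q^2u_i^3)^{\mp1}\prod_{j\neq i}h(u_i,u_j)\Lambda_2^{\pm}(u_i)+\nu_\pm\frac{u_i^{\mp2}b(u_i^2)}{b(q)}\frac{\prod_{k=0}^{2s}b(q^{1/2+k-s}\zeta u_i)b(q^{1/2+k-s}\zeta^{-1}u_i)}{\prod_{j\ne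 i}b(u_iu_j^{-1})b(qu_iu_j)}.$$ A *Bethe solution* of $E_\pm$ is a tuple $\bar u\in(\mathbb C^*)^{2s}$ with $E_\pm(u_i,\bar u_i)=0$ for all $i$, which is nontrivial ($u_i^2\ne u_i^{-2}$), admissible ($qu_i^2+q^{-1}u_i^{-2}\ne qu_j^2+q^{-1}u_j^{-2}$ for $i\ne j$), and at which the equations are defined ($b(qu_i^2)\neq0$). Put $$\theta(\bar u)=q^{-4s}\Big(\mathtt c^*(\zeta^2+\zeta^{-2})[2s]_q+q^{2s}(\mathtt bq^{2s}+\mathtt cq^{-2s})-q\mathtt c^*\sum_{j=1}^{2s}(qu_j^2+q^{-1}u_j^{-2})\Big),$$ $$\theta^*(\bar w)=q^{4s}\Big(\mathtt b(\zeta^2+\zeta^{-2})[2s]_q+q^{-2s}(\mathtt b^*q^{2s}+\mathtt c^*q^{-2s})-q^{-1}\mathtt b\sum_{j=1}^{2s}(qw_j^2+q^{-1}w_j^{-2})\Big).$$ Denote by $S_+^{M(i)}$ any Bethe solution $\bar u$ of $E_+$ with $\theta_M=\theta(\bar u)$, and by $S_-^{*N(i)}$ any Bethe solution $\bar w$ of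 $E_-$ with $\theta^*_N=\theta^*(\bar w)$. Hypothesis 2 says that these exist for all $0\le M,N\le2s$. **Statement.** Let $\mathcal N_{2s}(\bar w)=\prod_{k=1}^{2s}\big(qw_kb(w_k^2)A^*_{k,k-1}\big)^{-1}$ and $\mathcal N^*_{2s}(\bar u)=\prod_{k=1}^{2s}\big(-q^{-1}u_k^{-1}b(u_k^2)A_{k,k-1}\big)^{-1}$. 1. For every $M$ and every $\bar u'=S_+^{M(i)}$: $\ |\theta_M\rangle=\mathcal N^*_{2s}(\bar u')\,(P^{-1})_{2s,M}\,|\Psi^{2s}_+(\bar u',m_0)\rangle$. 2. For every $N$ and every $\bar w'=S_-^{*N(i)}$: $\ |\theta^*_N\rangle=\mathcal N_{2s}(\bar w')\,P_{2s,N}\,|\Psi^{2s}_-(\bar w',m_0)\rangle$. 3. Every Bethe solution $\bar u'$ of $E_+$ satisfies $\pi(A)|\Psi^{2s}_+(\bar u',m_0)\rangle=\theta(\bar u')|\Psi^{2s}_+(\bar u',m_0)\rangle$ and $\theta(\bar u')=\theta_M$ for some $0\le M\le 2s$; every Bethe solution $\bar w'$ of $E_-$ satisfies $\pi(A^*)|\Psi^{2s}_-(\bar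 w',m_0)\rangle=\theta^*(\bar w')|\Psi^{2s}_-(\bar w',m_0)\rangle$ and $\theta^*(\bar w')=\theta^*_N$ for some $0\le N\le 2s$. In particular, under Hypothesis 2, all the eigenvectors $|\theta_M\rangle$ and $|\theta^*_N\rangle$ are inhomogeneous Bethe states, with the normalizations in 1 and 2. -/

import Mathlib

open Module

noncomputable section

namespace AWBethe

/-- `b(x) = x - x⁻¹`. -/
def br (x : ℂ) : ℂ := x - x⁻¹

/-- The `q`-number `[n]_q`. -/
def qNum (q : ℂ) (n : ℕ) : ℂ := (q ^ n - (q ^ n)⁻¹) / (q - q⁻¹)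

/-- The `q`-commutator `[X, Y]_q = q X Y - q⁻¹ Y X`. -/
def qComm {R : Type*} [Ring R] [Algebra ℂ R] (q : ℂ) (X Y : R) : R :=
  q • (X * Y) - q⁻¹ • (Y * X)

/-! The Askey-Wilson algebra by generators and relations. -/

/-- The two generators. -/
inductive AWGen
  | A
  | Astar

/-- The two defining relations, inside the free algebra on `A`, `A*`. -/
inductive AWRel (q ρ ω η ηs : ℂ) : FreeAlgebra ℂ AWGen → FreeAlgebra ℂ AWGen → Prop
  | aw1 : AWRel q ρ ω η ηs
      (qComm q⁻¹ (FreeAlgebra.ι ℂ AWGen.A)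
        (qComm q (FreeAlgebra.ι ℂ AWGen.A) (FreeAlgebra.ι ℂ AWGen.Astar)))
      (ρ • FreeAlgebra.ι ℂ AWGen.Astar + ω • FreeAlgebra.ι ℂ AWGen.A + η • 1)
  | aw2 : AWRel q ρ ω η ηs
      (qComm q⁻¹ (FreeAlgebra.ι ℂ AWGen.Astar)
        (qComm q (FreeAlgebra.ι ℂ AWGen.Astar) (FreeAlgebra.ι ℂ AWGen.A)))
      (ρ • FreeAlgebra.ι ℂ AWGen.A + ω • FreeAlgebra.ι ℂ AWGen.Astar + ηs • 1)

/-- The Askey-Wilson algebra with structure constants `ρ, ω, η, η*`. -/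
abbrev AW (q ρ ω η ηs : ℂ) : Type := RingQuot (AWRel q ρ ω η ηs)

/-- The scalars of the problem: `r = q^{1/2}`, `ζ`, the numbers `b, c, b*, c*` that parametrize the
spectra, the scale `χ` of the off-diagonal entries of the `K`-matrix, and `n = 2s`. -/
structure Params where
  r : ℂ
  ζ : ℂ
  b : ℂ
  c : ℂ
  bs : ℂ
  cs : ℂ
  χ : ℂ
  n : ℕ

namespace Params

variable (p : Params)

/-- `q`, the square of the chosen square root `r`. -/
def q : ℂ := p.r ^ 2

/-- `θ_M = b q^{2M} + c q^{-2M}`. -/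
def θ (M : ℕ) : ℂ := p.b * p.q ^ (2 * M) + p.c * (p.q ^ (2 * M))⁻¹

/-- `θ*_N = b* q^{2N} + c* q^{-2N}`. -/
def θs (N : ℕ) : ℂ := p.bs * p.q ^ (2 * N) + p.cs * (p.q ^ (2 * N))⁻¹

/-- `ζ² + ζ⁻²`. -/
def z : ℂ := p.ζ ^ 2 + (p.ζ ^ 2)⁻¹

/-- `b q^{2s} + c q^{-2s}`. -/
def t : ℂ := p.b * p.q ^ p.n + p.c * (p.q ^ p.n)⁻¹

/-- `b* q^{2s} + c* q^{-2s}`. -/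
def ts : ℂ := p.bs * p.q ^ p.n + p.cs * (p.q ^ p.n)⁻¹

/-- `q^{2s+1} + q^{-2s-1}`. -/
def d : ℂ := p.q ^ (p.n + 1) + (p.q ^ (p.n + 1))⁻¹

/-- The structure constants of the algebra. -/
def ρ : ℂ := -(p.b * p.c * (p.q ^ 2 - (p.q ^ 2)⁻¹) ^ 2)

def ω : ℂ := (p.q - p.q⁻¹) ^ 2 * (p.b * p.c * p.z * p.d - p.t * p.ts)

def η : ℂ :=
  -((p.q ^ 2 - (p.q ^ 2)⁻¹) ^ 2 / (p.q + p.q⁻¹)) * (p.b * p.c) * (p.t * p.z - p.ts * p.d)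

def ηs : ℂ :=
  -((p.q ^ 2 - (p.q ^ 2)⁻¹) ^ 2 / (p.q + p.q⁻¹)) * (p.bs * p.cs) * (p.ts * p.z - p.t * p.d)

/-- The Askey-Wilson algebra with these structure constants. -/
abbrev Alg : Type := AW p.q p.ρ p.ω p.η p.ηs

/-- The generator `A`. -/
def A : p.Alg :=
  RingQuot.mkAlgHom ℂ (AWRel p.q p.ρ p.ω p.η p.ηs) (FreeAlgebra.ι ℂ AWGen.A)

/-- The generator `A*`. -/
def As : p.Alg :=
  RingQuot.mkAlgHom ℂ (AWRel p.q p.ρ p.ω p.η p.ηs) (FreeAlgebra.ι ℂ AWGen.Astar)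

/-! The reflection-algebra presentation: the entries of the `K`-matrix `K(u)`. -/

/-- `η̄(u) = (q + q⁻¹) ρ⁻¹ (η u + η* u⁻¹)`. -/
def ηbar (u : ℂ) : ℂ := (p.q + p.q⁻¹) * p.ρ⁻¹ * (p.η * u + p.ηs * u⁻¹)

def K11 (u : ℂ) : p.Alg :=
  br (u ^ 2) • ((p.q * u) • p.A - (p.q * u)⁻¹ • p.As) - p.ηbar u • 1

def K12 (u : ℂ) : p.Alg :=
  (p.χ * br (u ^ 2)) •
    (p.ρ⁻¹ • (qComm p.q p.As p.A + (p.ω / (p.q - p.q⁻¹)) • 1)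
      + ((p.q * u ^ 2 + (p.q * u ^ 2)⁻¹) / (p.q ^ 2 - (p.q ^ 2)⁻¹)) • 1)

def K21 (u : ℂ) : p.Alg :=
  (p.ρ * p.χ⁻¹ * br (u ^ 2)) •
    (p.ρ⁻¹ • (qComm p.q p.A p.As + (p.ω / (p.q - p.q⁻¹)) • 1)
      + ((p.q * u ^ 2 + (p.q * u ^ 2)⁻¹) / (p.q ^ 2 - (p.q ^ 2)⁻¹)) • 1)

def K22 (u : ℂ) : p.Alg :=
  br (u ^ 2) • ((p.q * u) • p.As - (p.q * u)⁻¹ • p.A) - p.ηbar u⁻¹ • 1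

/-! The dynamical operators; the sign `ε` takes the values `1` and `-1`. -/

/-- `γ^ε(u, m)`, equal to `β q^{-m} u - α q^m u⁻¹` for `ε = 1` and to
`α q^{-m} u - β q^m u⁻¹` for `ε = -1`. -/
def γ (ε : ℤ) (α β : ℂ) (u : ℂ) (m : ℤ) : ℂ :=
  α ^ ((1 - ε) / 2) * β ^ ((1 + ε) / 2) * p.q ^ (-m) * u
    - α ^ ((1 + ε) / 2) * β ^ ((1 - ε) / 2) * p.q ^ m * u⁻¹

/-- First component of the gauge vector `Y^ε(u, m) = (β q^{-εm} u^{-ε}, 1)ᵗ`. -/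
def gauge (ε : ℤ) (β : ℂ) (u : ℂ) (m : ℤ) : ℂ := β * p.q ^ (-ε * m) * u ^ (-ε)

/-- The dynamical operator `𝓑^ε(u, m)` with gauge parameters `α, β`: the `K`-matrix between the
covector `(1, -y(u⁻¹))`, which annihilates `Y^ε(u⁻¹, m)`, and the vector `Y^ε(u, m) = (y(u), 1)ᵗ`,
with the normalization `-ε (q u)^{-ε} / γ^ε(1, m + 1)`. -/
def dynB (ε : ℤ) (α β : ℂ) (u : ℂ) (m : ℤ) : p.Alg :=
  (-(ε : ℂ) * (p.q * u) ^ (-ε) / p.γ ε α β 1 (m + 1)) •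
    (p.gauge ε β u m • p.K11 u + p.K12 u
      - (p.gauge ε β u⁻¹ m * p.gauge ε β u m) • p.K21 u - p.gauge ε β u⁻¹ m • p.K22 u)

/-- The string `𝓑^ε(u₁, m + 2(L - 1)) ⋯ 𝓑^ε(u_L, m)`. -/
def stringB (ε : ℤ) (α β : ℂ) {L : ℕ} (u : Fin L → ℂ) (m : ℤ) : p.Alg :=
  (List.ofFn fun i : Fin L => p.dynB ε α β (u i) (m + 2 * ((L : ℤ) - 1 - (i : ℕ)))).prod

/-- The Bethe state `|Ψ_ε^L(ū, m₀)⟩ = π(B^ε(ū, m₀, L)) Ω` with gauge parameters `α` and `β = 0`. -/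
def betheState {V : Type*} [AddCommGroup V] [Module ℂ V] (π : p.Alg →ₐ[ℂ] Module.End ℂ V)
    (ε : ℤ) (α : ℂ) (m₀ : ℤ) (Ω : V) {L : ℕ} (u : Fin L → ℂ) : V :=
  π (p.stringB ε α 0 u m₀) Ω

/-! The Bethe equations of inhomogeneous type. -/

def f (u v : ℂ) : ℂ := br (p.q * v / u) * br (u * v) / (br (v / u) * br (p.q * u * v))

def h (u v : ℂ) : ℂ := br (p.q ^ 2 * u * v) * br (p.q * u / v) / (br (p.q * u * v) * br (u / v))

def Λ1 (ε : ℤ) (u : ℂ) : ℂ :=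
  (p.q ^ (p.n + 1))⁻¹ / u ^ ε
    * (p.q ^ (p.n + 1) * u * p.ζ⁻¹ - u⁻¹ * p.ζ) * (p.q ^ (p.n + 1) * u * p.ζ - u⁻¹ * p.ζ⁻¹)
    * (u * p.cs * (p.q ^ p.n)⁻¹ + u⁻¹ * p.b * p.q ^ p.n)
    * (u * (p.c / p.cs) ^ ((1 - ε) / 2) + u⁻¹ * (p.bs / p.b) ^ ((1 + ε) / 2))

def Λ2 (ε : ℤ) (u : ℂ) : ℂ :=
  br (u ^ 2) * (p.q ^ (p.n + 1))⁻¹ / (u ^ ε * br (p.q * u ^ 2))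
    * (p.q ^ ((p.n : ℤ) - 1) * u⁻¹ * p.ζ - u * p.ζ⁻¹)
    * (p.q ^ ((p.n : ℤ) - 1) * u⁻¹ * p.ζ⁻¹ - u * p.ζ)
    * (p.q ^ 2 * u * p.b * p.q ^ p.n + u⁻¹ * p.cs * (p.q ^ p.n)⁻¹)
    * (p.q ^ 2 * u * (p.bs / p.b) ^ ((1 + ε) / 2) + u⁻¹ * (p.c / p.cs) ^ ((1 - ε) / 2))

/-- `ν₊ = q^{-1-4s} c*` and `ν₋ = q^{1+4s} b`. -/
def ν (ε : ℤ) : ℂ :=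
  if ε = 1 then (p.q ^ (1 + 2 * p.n))⁻¹ * p.cs else p.q ^ (1 + 2 * p.n) * p.b

/-- The function `E_ε(u_i, ū_i)`; note `q^{1/2+k-s} = r^{1+2k-n}`. -/
def E (ε : ℤ) (u : Fin p.n → ℂ) (i : Fin p.n) : ℂ :=
  br (u i ^ 2) / br (p.q * u i ^ 2) * u i ^ ε
      * (∏ j ∈ Finset.univ.erase i, p.f (u i) (u j)) * p.Λ1 ε (u i)
    - (p.q ^ 2 * u i ^ 3) ^ (-ε) * (∏ j ∈ Finset.univ.erase i, p.h (u i) (u j)) * p.Λ2 ε (u i)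
    + p.ν ε * (u i ^ (-2 * ε) * br (u i ^ 2) / br p.q)
      * ((∏ k ∈ Finset.range (p.n + 1),
            br (p.r ^ (1 + 2 * (k : ℤ) - p.n) * p.ζ * u i)
              * br (p.r ^ (1 + 2 * (k : ℤ) - p.n) * p.ζ⁻¹ * u i))
          / ∏ j ∈ Finset.univ.erase i, (br (u i * (u j)⁻¹) * br (p.q * u i * u j)))

/-- The symmetrized Bethe root `U = (q u² + q⁻¹ u⁻²) / (q + q⁻¹)`. -/
def U (u : ℂ) : ℂ := (p.q * u ^ 2 + (p.q * u ^ 2)⁻¹) / (p.q + p.q⁻¹)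

/-- Nontrivial (`u_i ≠ 0`, `u_i² ≠ u_i⁻²`) admissible (`U_i ≠ U_j` for `i ≠ j`) solutions of the
equations `E_ε(u_i, ū_i) = 0`; the condition `b(q u_i²) ≠ 0` says that `E_ε` is defined at `ū`. -/
structure IsBetheSolution (ε : ℤ) (u : Fin p.n → ℂ) : Prop where
  ne_zero : ∀ i, u i ≠ 0
  nontrivial : ∀ i, u i ^ 2 ≠ (u i ^ 2)⁻¹
  regular : ∀ i, br (p.q * u i ^ 2) ≠ 0
  admissible : ∀ i j, i ≠ j → p.U (u i) ≠ p.U (u j)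
  bethe : ∀ i, p.E ε u i = 0

/-- The value of the spectrum of `A` attached to Bethe roots of `E₊`. -/
def θofRoots (u : Fin p.n → ℂ) : ℂ :=
  (p.q ^ (2 * p.n))⁻¹ * (p.cs * (p.ζ ^ 2 + (p.ζ ^ 2)⁻¹) * qNum p.q p.n
    + p.q ^ p.n * (p.b * p.q ^ p.n + p.c * (p.q ^ p.n)⁻¹)
    - p.q * p.cs * ∑ j, (p.q * u j ^ 2 + p.q⁻¹ * (u j ^ 2)⁻¹))

/-- The value of the spectrum of `A*` attached to Bethe roots of `E₋`. -/
def θsOfRoots (w : Fin p.n → ℂ) : ℂ :=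
  p.q ^ (2 * p.n) * (p.b * (p.ζ ^ 2 + (p.ζ ^ 2)⁻¹) * qNum p.q p.n
    + (p.q ^ p.n)⁻¹ * (p.bs * p.q ^ p.n + p.cs * (p.q ^ p.n)⁻¹)
    - p.q⁻¹ * p.b * ∑ j, (p.q * w j ^ 2 + p.q⁻¹ * (w j ^ 2)⁻¹))

/-- `ū = S₊^{M(i)}`. -/
def IsRootSetPlus (M : Fin (p.n + 1)) (u : Fin p.n → ℂ) : Prop :=
  p.IsBetheSolution 1 u ∧ p.θ M = p.θofRoots u

/-- `w̄ = S₋^{*N(i)}`. -/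
def IsRootSetMinus (N : Fin (p.n + 1)) (w : Fin p.n → ℂ) : Prop :=
  p.IsBetheSolution (-1) w ∧ p.θs N = p.θsOfRoots w

/-- The hypothesis that Bethe roots of inhomogeneous type exist for every eigenvalue. -/
def BetheRootsExist : Prop :=
  (∀ M, ∃ u, p.IsRootSetPlus M u) ∧ (∀ N, ∃ w, p.IsRootSetMinus N w)

/-! The representation, its eigenbases and the normalization coefficients. -/

variable {V : Type*} [AddCommGroup V] [Module ℂ V]

/-- `N_{2s}(w̄) = ∏_k (q w_k b(w_k²) A*_{k,k-1})⁻¹`, where `A*_{k,k-1}` is the entry of `π(A*)` in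
the eigenbasis `v` of `π(A)`. -/
def norm (π : p.Alg →ₐ[ℂ] Module.End ℂ V) (v : Basis (Fin (p.n + 1)) ℂ V) (w : Fin p.n → ℂ) : ℂ :=
  ∏ k : Fin p.n,
    (p.q * w k * br (w k ^ 2) * LinearMap.toMatrix v v (π p.As) k.succ k.castSucc)⁻¹

/-- `N*_{2s}(ū) = ∏_k (-q⁻¹ u_k⁻¹ b(u_k²) A_{k,k-1})⁻¹`, where `A_{k,k-1}` is the entry of `π(A)` in
the eigenbasis `vs` of `π(A*)`. -/
def normStar (π : p.Alg →ₐ[ℂ] Module.End ℂ V) (vs : Basis (Fin (p.n + 1)) ℂ V)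
    (u : Fin p.n → ℂ) : ℂ :=
  ∏ k : Fin p.n,
    (-p.q⁻¹ * (u k)⁻¹ * br (u k ^ 2) * LinearMap.toMatrix vs vs (π p.A) k.succ k.castSucc)⁻¹

/-- The transition matrix, `|θ*_N⟩ = ∑_M P_{MN} |θ_M⟩`. -/
def trans (v vs : Basis (Fin (p.n + 1)) ℂ V) : Matrix (Fin (p.n + 1)) (Fin (p.n + 1)) ℂ :=
  v.toMatrix vs

end Params

end AWBethe

end

noncomputable section

namespace AWBethe

namespace Params

variable {V : Type*} [AddCommGroup V] [Module ℂ V]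

/-! Write n = 2s, Ω = |θ*_0⟩ and X = ρ⁻¹([A*, A]_q + ω/(q - q⁻¹)). For β = 0 only K₁₂(u) survives in
the dynamical operator, and K₁₂(u) is a scalar times X - x(u) with x(u) = -(qu² + q⁻¹u⁻²)/(q² -
q⁻²). So a Bethe state is a scalar times f(X)Ω, where f is monic of degree n with roots x(u_i), and
the theorem becomes one about polynomials.

The defining relations say that A and A* commute with X up to factors q^{∓2}, modulo terms linear in
A, A* and 1 (`A_mul_X`, `B_mul_X`), and AΩ = (a₀ + a₁X)Ω (`A_lowest`). Hence A and A* act on the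
vectors f(X)Ω through linear maps `polyA`, `polyB` of ℂ[X] (`apply_aeval`). At a root of its
argument `polyA` is a two-term q-difference operator (`eval_polyA_root`), whose coefficients are
those of the Bethe equations. Moreover X is annihilated by an explicit F of degree n + 1
(`aeval_charFactor`).

The Bethe equations say that `polyA` f and q^{-2n}a₁F agree at the n distinct roots of f. The two
top coefficients fix what remains and produce θ(ū): `polyA` f = θ(ū) f + q^{-2n}a₁F, the
inhomogeneous TQ-relation (`polyA_rootPoly`). Applied to Ω the inhomogeneous term vanishes, so f(X)Ω
is an eigenvector of A.

In the basis |θ*_k⟩ the operator X climbs at most one step, with nonzero coefficient. So the last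
coordinate of f(X)Ω is a nonzero product independent of the roots (`repr_last_rootPoly`), which
gives both nonvanishing and the normalization. The statements for E₋ follow from those for E₊ by A ↔
A*, q → q⁻¹, u → u⁻¹, under which X → -X (`swap`, `swap_E`). -/

/-- An irreducible module of the Askey-Wilson algebra, given by the images `A, B` of the two
generators, together with eigenbases of `A` and `B` having the prescribed simple spectra. -/
structure IsLeonardRep (p : Params) (A B : Module.End ℂ V)
    (v vs : Basis (Fin (p.n + 1)) ℂ V) : Prop where
  r_ne : p.r ≠ 0
  q_pow_ne : ∀ k : ℕ, 0 < k → p.q ^ k ≠ 1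
  ζ_ne : p.ζ ≠ 0
  b_ne : p.b ≠ 0
  c_ne : p.c ≠ 0
  bs_ne : p.bs ≠ 0
  cs_ne : p.cs ≠ 0
  bc_eq : p.b * p.c = p.bs * p.cs
  aw1 : qComm p.q⁻¹ A (qComm p.q A B) = p.ρ • B + p.ω • A + p.η • 1
  aw2 : qComm p.q⁻¹ B (qComm p.q B A) = p.ρ • A + p.ω • B + p.ηs • 1
  irr : ∀ W : Submodule ℂ V, (∀ w ∈ W, A w ∈ W) → (∀ w ∈ W, B w ∈ W) → W = ⊥ ∨ W = ⊤
  eig : ∀ M, A (v M) = p.θ M • v M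
  eigs : ∀ N, B (vs N) = p.θs N • vs N
  θ_inj : ∀ M M' : Fin (p.n + 1), p.θ M = p.θ M' → M = M'
  θs_inj : ∀ N N' : Fin (p.n + 1), p.θs N = p.θs N' → N = N'

/-- The third Askey-Wilson generator. -/
def opX (p : Params) (A B : Module.End ℂ V) : Module.End ℂ V :=
  p.ρ⁻¹ • (qComm p.q B A + (p.ω / (p.q - p.q⁻¹)) • 1)

/-! ### Nonvanishing of scalars, and the defining relations rewritten in terms of X. -/

namespace IsLeonardRep

variable {p : Params} {A B : Module.End ℂ V} {v vs : Basis (Fin (p.n + 1)) ℂ V}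

lemma q_ne (h : p.IsLeonardRep A B v vs) : p.q ≠ 0 := pow_ne_zero 2 h.r_ne

lemma q_pow_sub_one_ne (h : p.IsLeonardRep A B v vs) {k : ℕ} (hk : 0 < k) : p.q ^ k - 1 ≠ 0 :=
  sub_ne_zero.2 (h.q_pow_ne k hk)

lemma q_sq_add_one_ne (h : p.IsLeonardRep A B v vs) : p.q ^ 2 + 1 ≠ 0 := by
  intro h0
  apply h.q_pow_sub_one_ne (k := 4) (by norm_num)
  linear_combination (p.q ^ 2 - 1) * h0

lemma q_sub_inv_ne (h : p.IsLeonardRep A B v vs) : p.q - p.q⁻¹ ≠ 0 := by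
  have h1 := h.q_ne
  have h2 := h.q_pow_sub_one_ne (k := 2) (by norm_num)
  intro h0
  apply h2
  field_simp at h0
  linear_combination h0

lemma q_add_inv_ne (h : p.IsLeonardRep A B v vs) : p.q + p.q⁻¹ ≠ 0 := by
  have h1 := h.q_ne
  have h2 := h.q_sq_add_one_ne
  intro h0
  apply h2
  field_simp at h0
  linear_combination h0

lemma q_sq_sub_inv_ne (h : p.IsLeonardRep A B v vs) : p.q ^ 2 - (p.q ^ 2)⁻¹ ≠ 0 := by
  have h1 := mul_ne_zero h.q_sub_inv_ne h.q_add_inv_ne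
  have h2 := h.q_ne
  convert h1 using 1
  field_simp
  ring

lemma ρ_ne (h : p.IsLeonardRep A B v vs) : p.ρ ≠ 0 :=
  neg_ne_zero.2 (mul_ne_zero (mul_ne_zero h.b_ne h.c_ne) (pow_ne_zero 2 h.q_sq_sub_inv_ne))

/-- This is the second Askey–Wilson relation divided by ρ. The constant ω/(q - q⁻¹) in X is chosen
so that the term ωA* cancels. -/
lemma B_mul_X (h : p.IsLeonardRep A B v vs) :
    B * p.opX A B = p.q ^ 2 • (p.opX A B * B) + p.q • A + (p.q * p.ηs / p.ρ) • 1 := by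
  have h1 := h.q_ne
  have h2 := h.ρ_ne
  have h3 := h.q_pow_sub_one_ne (k := 2) (by norm_num)
  have h4 := h.aw2
  simp only [qComm, opX, mul_add, mul_sub, add_mul, sub_mul, smul_mul_assoc, mul_smul_comm,
    mul_assoc, mul_one, one_mul, smul_sub, smul_add, smul_smul] at h4 ⊢
  linear_combination (norm := skip) (p.q * p.ρ⁻¹) • h4
  match_scalars <;> field_simp <;> ring
  
lemma A_mul_X (h : p.IsLeonardRep A B v vs) :
    A * p.opX A B = (p.q ^ 2)⁻¹ • (p.opX A B * A) - p.q⁻¹ • B - (p.q⁻¹ * p.η / p.ρ) • 1 := by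
  have h1 := h.q_ne
  have h2 := h.ρ_ne
  have h3 := h.q_pow_sub_one_ne (k := 2) (by norm_num)
  have h4 := h.aw1
  simp only [qComm, opX, mul_add, mul_sub, add_mul, sub_mul, smul_mul_assoc, mul_smul_comm,
    mul_assoc, mul_one, one_mul, smul_sub, smul_add, smul_smul] at h4 ⊢
  linear_combination (norm := skip) (-p.q⁻¹ * p.ρ⁻¹) • h4
  match_scalars <;> field_simp <;> ring

end IsLeonardRep

end Params

/-! ### The matrix of A in the eigenbasis of A*. -/

namespace Params

lemma N_pow (p : Params) : p.q ^ (p.n + 1) = p.q * p.q ^ p.n := by rw [pow_succ, mul_comm]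

/-- The telescoping part of the diagonal entries of `A` when `b* = c* q²`. -/
def diagPart (p : Params) (Q : ℂ) : ℂ :=
  (Q - p.q ^ 2 * (p.q ^ p.n) ^ 2) * (p.b * p.bs * Q + p.b * p.c * p.q * p.z / p.q ^ p.n
    + p.c * p.cs * p.q ^ 2 / ((p.q ^ p.n) ^ 2 * Q)) / ((p.q ^ 2 - 1) * (p.cs * p.q ^ 2) * (Q + 1))

variable {V : Type*} [AddCommGroup V] [Module ℂ V]

namespace IsLeonardRep

variable {p : Params} {A B : Module.End ℂ V} {v vs : Basis (Fin (p.n + 1)) ℂ V}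

lemma repr_B (h : p.IsLeonardRep A B v vs) (x : V) (i : Fin (p.n + 1)) :
    vs.repr (B x) i = p.θs i * vs.repr x i := by
  have h1 : vs.coord i ∘ₗ B = p.θs i • vs.coord i := by
    refine vs.ext fun j => ?_
    by_cases hij : j = i
    · subst hij; simp [h.eigs]
    · simp [h.eigs, hij]
  simpa using LinearMap.congr_fun h1 x

/-- A* is diagonal in this basis and the second relation is linear in A, so each of its matrix
entries constrains a single entry of A. -/
lemma entry_relation (h : p.IsLeonardRep A B v vs) (i j : Fin (p.n + 1)) :
    vs.repr (A (vs j)) i *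
        (p.θs i ^ 2 - (p.q ^ 2 + (p.q ^ 2)⁻¹) * p.θs i * p.θs j + p.θs j ^ 2 - p.ρ) =
      (p.ω * p.θs j + p.ηs) * vs.repr (vs j) i := by
  have h1 := h.q_ne
  have h2 := congrArg (fun T : Module.End ℂ V => vs.repr (T (vs j)) i) h.aw2
  simp only [qComm, LinearMap.sub_apply, LinearMap.smul_apply, Module.End.mul_apply, map_sub,
    map_smul, h.eigs, LinearMap.add_apply, map_add, Finsupp.sub_apply, Finsupp.add_apply,
    Finsupp.smul_apply, smul_eq_mul, h.repr_B, Module.End.one_apply, inv_inv] at h2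
  linear_combination (norm := skip) h2
  field_simp
  ring

/-- Equality would force θ*_i = θ*_j whenever i + j = m, and the sums i + j with i < j ≤ n cover 1,
…, 2n - 1. -/
lemma bs_mul_pow_ne (h : p.IsLeonardRep A B v vs) {m : ℕ} (hm : 1 ≤ m) (hmn : m + 1 ≤ 2 * p.n) :
    p.bs * p.q ^ (2 * m) ≠ p.cs := by
  have hq := h.q_ne
  have key : ∀ i j : ℕ, i < j → j ≤ p.n → p.bs * p.q ^ (2 * (i + j)) ≠ p.cs := by
    intro i j hij hj h0
    have := h.θs_inj ⟨i, by omega⟩ ⟨j, by omega⟩ (by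
      simp only [θs, ← h0]
      field_simp
      ring)
    simp at this
    omega
  rcases le_or_gt m p.n with hc | hc
  · simpa using key 0 m (by omega) hc
  · have := key (m - p.n) p.n (by omega) le_rfl
    rwa [Nat.sub_add_cancel hc.le] at this

lemma θs_quadratic_factor {q bs cs I J : ℂ} (hq : q ≠ 0) (hI : I ≠ 0) (hJ : J ≠ 0) :
    (bs * I + cs * I⁻¹) ^ 2 - (q ^ 2 + (q ^ 2)⁻¹) * (bs * I + cs * I⁻¹) * (bs * J + cs * J⁻¹)
        + (bs * J + cs * J⁻¹) ^ 2 + bs * cs * (q ^ 2 - (q ^ 2)⁻¹) ^ 2 =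
      (I - q ^ 2 * J) * (q ^ 2 * I - J) * (bs * (I * J * q ^ 2) - cs)
        * (bs * (I * J) - cs * q ^ 2) / (q ^ 2 * I * J) ^ 2 := by
  field_simp
  ring

/-- `A` is lower Hessenberg in the eigenbasis of `B`. -/
lemma entry_eq_zero (h : p.IsLeonardRep A B v vs) {i j : Fin (p.n + 1)} (hij : (j : ℕ) + 2 ≤ i) :
    vs.repr (A (vs j)) i = 0 := by
  have hq := h.q_ne
  have h1 := h.entry_relation i j
  have hne : j ≠ i := by rintro rfl; omega
  have hi := i.is_lt
  rw [Basis.repr_self, Finsupp.single_eq_of_ne hne.symm, mul_zero, mul_eq_zero] at h1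
  refine h1.resolve_right ?_
  have h2 := θs_quadratic_factor (bs := p.bs) (cs := p.cs) hq
    (pow_ne_zero (2 * (i : ℕ)) hq) (pow_ne_zero (2 * (j : ℕ)) hq)
  simp only [θs, ρ, h.bc_eq, sub_neg_eq_add]
  rw [h2]
  have e1 : p.q ^ (2 * (i : ℕ)) - p.q ^ 2 * p.q ^ (2 * (j : ℕ)) =
      p.q ^ (2 + 2 * (j : ℕ)) * (p.q ^ (2 * ((i : ℕ) - j - 1)) - 1) := by
    rw [mul_sub, ← pow_add, ← pow_add, mul_one]
    congr 2; omega
  have e2 : p.q ^ 2 * p.q ^ (2 * (i : ℕ)) - p.q ^ (2 * (j : ℕ)) =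
      p.q ^ (2 * (j : ℕ)) * (p.q ^ (2 * ((i : ℕ) - j + 1)) - 1) := by
    rw [mul_sub, ← pow_add, ← pow_add, mul_one]
    congr 2; omega
  have e3 : p.q ^ (2 * (i : ℕ)) * p.q ^ (2 * (j : ℕ)) * p.q ^ 2 =
      p.q ^ (2 * ((i : ℕ) + j + 1)) := by
    rw [← pow_add, ← pow_add]; congr 1; omega
  have e4 : p.bs * (p.q ^ (2 * (i : ℕ)) * p.q ^ (2 * (j : ℕ))) - p.cs * p.q ^ 2 =
      (p.bs * p.q ^ (2 * ((i : ℕ) + j - 1)) - p.cs) * p.q ^ 2 := by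
    rw [sub_mul, mul_assoc, ← pow_add, ← pow_add]
    congr 3; omega
  rw [e1, e2, e3, e4]
  refine div_ne_zero (mul_ne_zero (mul_ne_zero (mul_ne_zero (mul_ne_zero ?_ ?_)
    (mul_ne_zero ?_ ?_)) ?_) (mul_ne_zero ?_ ?_)) (by simp [hq])
  · exact pow_ne_zero _ hq
  · exact h.q_pow_sub_one_ne (by omega)
  · exact pow_ne_zero _ hq
  · exact h.q_pow_sub_one_ne (by omega)
  · exact sub_ne_zero.2 (h.bs_mul_pow_ne (by omega) (by omega))
  · exact sub_ne_zero.2 (h.bs_mul_pow_ne (by omega) (by omega))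
  · exact pow_ne_zero _ hq

lemma repr_apply_eq_sum (x : V) (i : Fin (p.n + 1)) :
    vs.repr (A x) i = ∑ j, vs.repr x j * vs.repr (A (vs j)) i := by
  conv_lhs => rw [← vs.sum_repr x]
  simp only [map_sum, map_smul, Finsupp.finsetSum_apply, Finsupp.smul_apply, smul_eq_mul]

/-- If this entry vanished, the span of the first k + 1 eigenvectors of A* would be a proper nonzero
invariant subspace. -/
lemma subdiag_ne_zero (h : p.IsLeonardRep A B v vs) (k : Fin p.n) :
    vs.repr (A (vs k.castSucc)) k.succ ≠ 0 := by
  intro h0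
  let W : Submodule ℂ V :=
    { carrier := {x | ∀ i : Fin (p.n + 1), (k : ℕ) < i → vs.repr x i = 0}
      add_mem' := fun {x y} hx hy i hi => by simp [hx i hi, hy i hi]
      zero_mem' := fun i _ => by simp
      smul_mem' := fun a x hx i hi => by simp [hx i hi] }
  have hA : ∀ w ∈ W, A w ∈ W := by
    intro w hw i hi
    rw [repr_apply_eq_sum]
    refine Finset.sum_eq_zero fun j _ => ?_
    by_cases hj : (k : ℕ) < j
    · rw [hw j hj, zero_mul]
    · by_cases hij : (j : ℕ) + 2 ≤ i
      · rw [h.entry_eq_zero hij, mul_zero]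
      · have e1 : j = k.castSucc := Fin.ext (by simp; omega)
        have e2 : i = k.succ := Fin.ext (by simp; omega)
        rw [e1, e2, h0, mul_zero]
  have hB : ∀ w ∈ W, B w ∈ W := by
    intro w hw i hi
    rw [h.repr_B, hw i hi, mul_zero]
  rcases h.irr W hA hB with hW | hW
  · have : vs 0 ∈ W := by
      intro i hi
      rw [Basis.repr_self, Finsupp.single_eq_of_ne]
      rintro rfl
      simp at hi
    rw [hW, Submodule.mem_bot] at this
    exact vs.ne_zero 0 this
  · have : vs k.succ ∈ W := hW ▸ Submodule.mem_top
    have := this k.succ (by simp)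
    simp at this

lemma diag_relation (h : p.IsLeonardRep A B v vs) (i : Fin (p.n + 1)) :
    vs.repr (A (vs i)) i *
        ((p.q - p.q⁻¹) ^ 2 * (p.bs * p.cs * (p.q + p.q⁻¹) ^ 2 - p.θs i ^ 2)) =
      p.ω * p.θs i + p.ηs := by
  have h1 := h.entry_relation i i
  have hq := h.q_ne
  simp only [Basis.repr_self, Finsupp.single_eq_same, mul_one] at h1
  rw [← h1, ρ, h.bc_eq]
  congr 1
  field_simp
  ring

lemma trace_eq (h : p.IsLeonardRep A B v vs) :
    ∑ i, vs.repr (A (vs i)) i = ∑ i : Fin (p.n + 1), p.θ i := by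
  have h1 := LinearMap.trace_eq_matrix_trace ℂ vs A
  rw [LinearMap.trace_eq_matrix_trace ℂ v A] at h1
  simp only [Matrix.trace, Matrix.diag, LinearMap.toMatrix_apply, h.eig] at h1
  simpa using h1.symm

/-- When b* = c*q², the factor in `diag_relation` is proportional to (Q² - 1)(q⁴Q² - 1) with Q =
q^{2i}. It vanishes at i = 0 only, so the relation still determines every other diagonal entry; the
telescoping form serves to sum them. -/
lemma diag_eq (h : p.IsLeonardRep A B v vs) (hs : p.bs = p.cs * p.q ^ 2) (i : Fin (p.n + 1))
    (hi : 0 < (i : ℕ)) :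
    vs.repr (A (vs i)) i =
      p.θ i + p.diagPart (p.q ^ (2 * (i : ℕ))) - p.diagPart (p.q ^ (2 * ((i : ℕ) + 1))) := by
  have h1 := h.diag_relation i
  have hq := h.q_ne
  have hb := h.b_ne
  have hcs := h.cs_ne
  have hc : p.c = p.cs ^ 2 * p.q ^ 2 / p.b := by
    have := h.bc_eq
    field_simp
    rw [mul_comm, this, hs]; ring
  have h2 : p.q ^ (2 * (i : ℕ)) - 1 ≠ 0 := h.q_pow_sub_one_ne (by omega)
  have h3 : p.q ^ (2 * (i : ℕ)) + 1 ≠ 0 := by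
    intro h0
    apply h.q_pow_sub_one_ne (k := 4 * i) (by omega)
    have : p.q ^ (4 * (i : ℕ)) = (p.q ^ (2 * (i : ℕ))) ^ 2 := by rw [← pow_mul]; congr 1; ring
    rw [this]
    linear_combination (p.q ^ (2 * (i : ℕ)) - 1) * h0
  have e4 : p.q ^ (2 * ((i : ℕ) + 1)) = p.q ^ 2 * p.q ^ (2 * (i : ℕ)) := by
    rw [← pow_add]; congr 1; ring
  have h4 : p.q ^ 2 * p.q ^ (2 * (i : ℕ)) + 1 ≠ 0 := by
    intro h0
    apply h.q_pow_sub_one_ne (k := 4 * (i + 1)) (by omega)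
    have : p.q ^ (4 * ((i : ℕ) + 1)) = (p.q ^ 2 * p.q ^ (2 * (i : ℕ))) ^ 2 := by
      rw [← pow_add, ← pow_mul]; congr 1; ring
    rw [this]
    linear_combination (p.q ^ 2 * p.q ^ (2 * (i : ℕ)) - 1) * h0
  have h5 : p.q ^ 2 * p.q ^ (2 * (i : ℕ)) - 1 ≠ 0 := by
    rw [← e4]; exact h.q_pow_sub_one_ne (by omega)
  have h6 := h.q_pow_sub_one_ne (k := 2) (by norm_num)
  have h7 := h.q_sq_add_one_ne
  have hN : p.q ^ p.n ≠ 0 := pow_ne_zero _ hq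
  have hQ : p.q ^ (2 * (i : ℕ)) ≠ 0 := pow_ne_zero _ hq
  rw [e4]
  simp only [θs, ω, ηs, t, ts, d, diagPart, θ, N_pow, hs, hc] at h1 ⊢
  generalize p.q ^ (2 * (i : ℕ)) = Q at *
  generalize p.q ^ p.n = N at *
  generalize p.z = z at *
  generalize vs.repr (A (vs i)) i = a at *
  generalize p.q = q at *
  generalize p.b = b at *
  generalize p.cs = cs at *
  have h8 : (q - q⁻¹) ^ 2 * (cs * q ^ 2 * cs * (q + q⁻¹) ^ 2 - (cs * q ^ 2 * Q + cs * Q⁻¹) ^ 2) =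
      - (q ^ 2 - 1) ^ 2 * cs ^ 2 * (Q - 1) * (Q + 1) * (q ^ 2 * Q + 1) * (q ^ 2 * Q - 1)
        / (q ^ 2 * Q ^ 2) := by
    field_simp
    ring
  rw [h8] at h1
  have h9 : - (q ^ 2 - 1) ^ 2 * cs ^ 2 * (Q - 1) * (Q + 1) * (q ^ 2 * Q + 1) * (q ^ 2 * Q - 1)
        / (q ^ 2 * Q ^ 2) ≠ 0 := by
    simp [*]
  refine mul_right_cancel₀ h9 (h1.trans ?_)
  have h10 : q + q⁻¹ = (q ^ 2 + 1) / q := by field_simp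
  rw [h10]
  field_simp
  ring

/-- At i = 0 the factor in `diag_relation` is proportional to (b* - c*q²)(b*q² - c*). If the first
factor is nonzero it can be cancelled; otherwise the entry is recovered from the trace of A. The
second factor is left undivided, since it may vanish when n = 0 and `A_lowest` needs the product
anyway. -/
lemma entry_zero (h : p.IsLeonardRep A B v vs) :
    vs.repr (A (vs 0)) 0 * (p.bs * p.q ^ 2 - p.cs) =
      p.q * (p.b * p.c) * (p.q ^ p.n - (p.q ^ p.n)⁻¹) * p.z
        + p.t * (p.q ^ 2 * p.bs * p.q ^ p.n - p.cs * (p.q ^ p.n)⁻¹) := by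
  have hq := h.q_ne
  have hN : p.q ^ p.n ≠ 0 := pow_ne_zero _ hq
  have hcs := h.cs_ne
  have hb := h.b_ne
  have h6 := h.q_pow_sub_one_ne (k := 2) (by norm_num)
  have h7 := h.q_sq_add_one_ne
  by_cases hs : p.bs = p.cs * p.q ^ 2
  · have h1 := h.trace_eq
    rw [Fin.sum_univ_succ, Fin.sum_univ_succ] at h1
    have h2 : ∀ i : Fin p.n, vs.repr (A (vs i.succ)) i.succ = p.θ (i.succ : Fin (p.n + 1))
        + (p.diagPart (p.q ^ (2 * ((i : ℕ) + 1))) - p.diagPart (p.q ^ (2 * ((i : ℕ) + 1 + 1)))) :=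
      fun i => by rw [h.diag_eq hs i.succ (by simp), add_sub_assoc]; simp
    simp only [h2, Finset.sum_add_distrib] at h1
    rw [Fin.sum_univ_eq_sum_range (fun i => p.diagPart (p.q ^ (2 * (i + 1)))
      - p.diagPart (p.q ^ (2 * (i + 1 + 1)))),
      Finset.sum_range_sub' (fun i => p.diagPart (p.q ^ (2 * (i + 1))))] at h1
    -- The upper end of the telescoping sum drops out, so the trace identity leaves only the lower
    -- end, at Q = q².
    have h3 : p.diagPart (p.q ^ (2 * (p.n + 1))) = 0 := by
      have : p.q ^ (2 * (p.n + 1)) = p.q ^ 2 * (p.q ^ p.n) ^ 2 := by ring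
      simp [diagPart, this]
    have h4 : vs.repr (A (vs 0)) 0 = p.b + p.c - p.diagPart (p.q ^ 2) := by
      rw [h3] at h1
      simp only [Fin.val_zero, θ] at h1
      simp only [mul_zero, pow_zero, zero_add, mul_one] at h1
      linear_combination h1
    rw [h4]
    have hc : p.c = p.cs ^ 2 * p.q ^ 2 / p.b := by
      have := h.bc_eq
      field_simp
      rw [mul_comm, this, hs]; ring
    simp only [diagPart, t, hs, hc]
    field_simp
    ring
  · have h1 := h.diag_relation 0
    have h2 : p.bs - p.cs * p.q ^ 2 ≠ 0 := sub_ne_zero.2 hs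
    have hc : p.c = p.bs * p.cs / p.b := by
      have := h.bc_eq
      field_simp
      rw [mul_comm, this]
    simp only [θs, ω, ηs, t, ts, d, N_pow, hc, Fin.val_zero, mul_zero, pow_zero] at h1 ⊢
    generalize p.q ^ p.n = N at *
    generalize p.z = z at *
    generalize vs.repr (A (vs 0)) 0 = a at *
    generalize p.q = q at *
    generalize p.b = b at *
    generalize p.cs = cs at *
    generalize p.bs = bs at *
    have h10 : q + q⁻¹ = (q ^ 2 + 1) / q := by field_simp
    rw [h10] at h1
    field_simp at h1
    have h11 : (q ^ 2 - 1) ^ 2 * (q ^ 2 + 1) * (bs - cs * q ^ 2) ≠ 0 := by simp [h6, h7, h2]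
    field_simp
    refine mul_left_cancel₀ h11 ?_
    linear_combination (-1) * h1

end IsLeonardRep

end Params

/-! ### Transport of A and A* to polynomials in X. -/

namespace Params

/-- The coefficients of `A Ω = (a₀ + a₁ X) Ω`, for `Ω` the lowest eigenvector of `A*`. -/
def a0 (p : Params) : ℂ := p.t * p.q ^ p.n - p.z * p.cs / (p.q * p.q ^ p.n)

def a1 (p : Params) : ℂ := -(p.cs / p.q * (p.q ^ 2 - (p.q ^ 2)⁻¹))

/-- The spectral parametrization of `X`. -/
def xval (p : Params) (w : ℂ) : ℂ := -((w + w⁻¹) / (p.q ^ 2 - (p.q ^ 2)⁻¹))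

open Polynomial in
/-- The polynomials representing the action of `A` and `A*` on `X ^ k Ω`. -/
def monomialAction (p : Params) : ℕ → ℂ[X] × ℂ[X]
  | 0 => (C p.a0 + C p.a1 * X, C (p.θs 0))
  | k + 1 =>
    (C (p.q ^ 2)⁻¹ * (X * (monomialAction p k).1) - C p.q⁻¹ * (monomialAction p k).2
        - C (p.q⁻¹ * p.η / p.ρ) * X ^ k,
      C (p.q ^ 2) * (X * (monomialAction p k).2) + C p.q * (monomialAction p k).1
        + C (p.q * p.ηs / p.ρ) * X ^ k)

open Polynomial in
/-- The action of `A` transported to polynomials in `X`. -/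
def polyA (p : Params) : ℂ[X] →ₗ[ℂ] ℂ[X] :=
  (Polynomial.basisMonomials ℂ).constr ℂ fun k => (p.monomialAction k).1

open Polynomial in
/-- The action of `A*` transported to polynomials in `X`. -/
def polyB (p : Params) : ℂ[X] →ₗ[ℂ] ℂ[X] :=
  (Polynomial.basisMonomials ℂ).constr ℂ fun k => (p.monomialAction k).2

section Poly

open Polynomial

variable (p : Params)

lemma polyA_X_pow (k : ℕ) : p.polyA (X ^ k) = (p.monomialAction k).1 := by
  have h := (Polynomial.basisMonomials ℂ).constr_basis ℂ (fun k => (p.monomialAction k).1) k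
  rwa [Polynomial.coe_basisMonomials,
    show (fun s => monomial s (1 : ℂ)) k = X ^ k from monomial_one_right_eq_X_pow k] at h

lemma polyB_X_pow (k : ℕ) : p.polyB (X ^ k) = (p.monomialAction k).2 := by
  have h := (Polynomial.basisMonomials ℂ).constr_basis ℂ (fun k => (p.monomialAction k).2) k
  rwa [Polynomial.coe_basisMonomials,
    show (fun s => monomial s (1 : ℂ)) k = X ^ k from monomial_one_right_eq_X_pow k] at h

lemma polyA_one : p.polyA 1 = C p.a0 + C p.a1 * X := by
  simpa [monomialAction] using p.polyA_X_pow 0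

lemma polyB_one : p.polyB 1 = C (p.θs 0) := by
  simpa [monomialAction] using p.polyB_X_pow 0

lemma polyA_C_mul (a : ℂ) (f : ℂ[X]) : p.polyA (C a * f) = C a * p.polyA f := by
  rw [← smul_eq_C_mul, map_smul, smul_eq_C_mul]

lemma polyB_C_mul (a : ℂ) (f : ℂ[X]) : p.polyB (C a * f) = C a * p.polyB f := by
  rw [← smul_eq_C_mul, map_smul, smul_eq_C_mul]

lemma polyA_X_mul (f : ℂ[X]) : p.polyA (X * f) =
    C (p.q ^ 2)⁻¹ * (X * p.polyA f) - C p.q⁻¹ * p.polyB f - C (p.q⁻¹ * p.η / p.ρ) * f := by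
  induction f using Polynomial.induction_on' with
  | add f g hf hg => rw [mul_add, map_add, hf, hg, map_add, map_add]; ring
  | monomial k a =>
    rw [← C_mul_X_pow_eq_monomial, mul_left_comm, ← pow_succ']
    simp only [polyA_C_mul, polyB_C_mul, polyA_X_pow, polyB_X_pow, monomialAction]
    ring

lemma polyB_X_mul (f : ℂ[X]) : p.polyB (X * f) =
    C (p.q ^ 2) * (X * p.polyB f) + C p.q * p.polyA f + C (p.q * p.ηs / p.ρ) * f := by
  induction f using Polynomial.induction_on' with
  | add f g hf hg => rw [mul_add, map_add, hf, hg, map_add, map_add]; ring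
  | monomial k a =>
    rw [← C_mul_X_pow_eq_monomial, mul_left_comm, ← pow_succ']
    simp only [polyA_C_mul, polyB_C_mul, polyA_X_pow, polyB_X_pow, monomialAction]
    ring

lemma polyA_X_sub_C_mul (a : ℂ) (f : ℂ[X]) : p.polyA ((X - C a) * f) =
    C (p.q ^ 2)⁻¹ * (X * p.polyA f) - C p.q⁻¹ * p.polyB f - C (p.q⁻¹ * p.η / p.ρ) * f
      - C a * p.polyA f := by
  rw [sub_mul, map_sub, polyA_X_mul, polyA_C_mul]

lemma polyB_X_sub_C_mul (a : ℂ) (f : ℂ[X]) : p.polyB ((X - C a) * f) =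
    C (p.q ^ 2) * (X * p.polyB f) + C p.q * p.polyA f + C (p.q * p.ηs / p.ρ) * f
      - C a * p.polyB f := by
  rw [sub_mul, map_sub, polyB_X_mul, polyB_C_mul]

/-- At a root of the argument, `polyA` and `polyB` act as two-term difference operators. -/
lemma eval_polyA_polyB_root {x₀ xp xm Dp Dm Ep Em : ℂ}
    (hp : Dp * xp = (p.q ^ 2)⁻¹ * x₀ * Dp - p.q⁻¹ * Ep)
    (hm : Dm * xm = (p.q ^ 2)⁻¹ * x₀ * Dm - p.q⁻¹ * Em)
    (hp' : Ep * xp = p.q ^ 2 * x₀ * Ep + p.q * Dp)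
    (hm' : Em * xm = p.q ^ 2 * x₀ * Em + p.q * Dm)
    (hA : Dp + Dm = (p.q ^ 2)⁻¹ * (x₀ * (p.a0 + p.a1 * x₀)) - p.q⁻¹ * p.θs 0
      - p.q⁻¹ * p.η / p.ρ - x₀ * (p.a0 + p.a1 * x₀))
    (hB : Ep + Em = p.q ^ 2 * (x₀ * p.θs 0) + p.q * (p.a0 + p.a1 * x₀) + p.q * p.ηs / p.ρ
      - x₀ * p.θs 0) (f : ℂ[X]) :
    (p.polyA ((X - C x₀) * f)).eval x₀ = Dp * f.eval xp + Dm * f.eval xm ∧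
      (p.polyB ((X - C x₀) * f)).eval x₀ = Ep * f.eval xp + Em * f.eval xm := by
  -- At x₀ the factor X - x₀ kills the constant term of the recursion, so the pair of values obeys a
  -- homogeneous 2 × 2 recursion in k. The hypotheses `hp`, `hp'` and `hm`, `hm'` say that (Dp, Ep)
  -- and (Dm, Em) satisfy the eigenvector equations of its matrix for xp and xm; `hA` and `hB` match
  -- the initial values.
  have key : ∀ k : ℕ, (p.polyA ((X - C x₀) * X ^ k)).eval x₀ = Dp * xp ^ k + Dm * xm ^ k ∧
      (p.polyB ((X - C x₀) * X ^ k)).eval x₀ = Ep * xp ^ k + Em * xm ^ k := by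
    intro k
    induction k with
    | zero =>
      rw [pow_zero, polyA_X_sub_C_mul, polyB_X_sub_C_mul, polyA_one, polyB_one]
      simp only [eval_sub, eval_add, eval_mul, eval_C, eval_X, eval_one]
      constructor
      · linear_combination -hA
      · linear_combination -hB
    | succ k ih =>
      have e : (X - C x₀) * X ^ (k + 1) = X * ((X - C x₀) * X ^ k) := by ring
      rw [e, polyA_X_mul, polyB_X_mul]
      simp only [eval_sub, eval_add, eval_mul, eval_C, eval_X, ih.1, ih.2, eval_pow]
      constructor
      · linear_combination -xp ^ k * hp - xm ^ k * hm
      · linear_combination -xp ^ k * hp' - xm ^ k * hm'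
  induction f using Polynomial.induction_on' with
  | add f g hf hg =>
    simp only [mul_add, map_add, eval_add, hf, hg]
    constructor <;> ring
  | monomial k a =>
    rw [← C_mul_X_pow_eq_monomial, mul_left_comm, polyA_C_mul, polyB_C_mul]
    simp only [eval_mul, eval_C, eval_pow, eval_X, (key k).1, (key k).2]
    constructor <;> ring

/-- Top coefficients of `polyA` and `polyB` on a product of linear factors. -/
lemma coeff_polyA_prod (hq : p.q ≠ 0) {ι : Type*} (s : Finset ι) (a : ι → ℂ) :
    (∀ j, s.card + 1 < j → (p.polyA (∏ i ∈ s, (X - C (a i)))).coeff j = 0) ∧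
    (p.polyA (∏ i ∈ s, (X - C (a i)))).coeff (s.card + 1) = (p.q ^ (2 * s.card))⁻¹ * p.a1 ∧
    (p.polyA (∏ i ∈ s, (X - C (a i)))).coeff s.card =
      (p.q ^ (2 * s.card))⁻¹ * (p.a0 - p.q ^ 2 * (∑ i ∈ s, a i) * p.a1) ∧
    (∀ j, s.card < j → (p.polyB (∏ i ∈ s, (X - C (a i)))).coeff j = 0) := by
  classical
  induction s using Finset.induction_on with
  | empty =>
    simp only [Finset.prod_empty, Finset.card_empty, Finset.sum_empty, polyA_one, polyB_one,
      coeff_add, coeff_C_mul, coeff_X, coeff_C]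
    refine ⟨fun j hj => ?_, by simp, by simp, fun j hj => ?_⟩
    · simp [show j ≠ 0 by omega, show 1 ≠ j by omega]
    · simp [show j ≠ 0 by omega]
  | insert i s hi ih =>
    obtain ⟨h1, h2, h3, h4⟩ := ih
    have hdeg : ∀ j, s.card < j → (∏ i ∈ s, (X - C (a i))).coeff j = 0 := fun j hj =>
      coeff_eq_zero_of_natDegree_lt (by rwa [natDegree_finsetProd_X_sub_C_eq_card])
    rw [Finset.prod_insert hi, Finset.card_insert_of_notMem hi, Finset.sum_insert hi,
      polyA_X_sub_C_mul, polyB_X_sub_C_mul]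
    simp only [coeff_add, coeff_sub, coeff_C_mul]
    refine ⟨fun j hj => ?_, ?_, ?_, fun j hj => ?_⟩
    · obtain ⟨j, rfl⟩ : ∃ k, j = k + 1 := ⟨j - 1, by omega⟩
      rw [coeff_X_mul, h1 j (by omega), h1 (j + 1) (by omega), h4 _ (by omega),
        hdeg _ (by omega)]
      ring
    · rw [coeff_X_mul, h2, h1 _ (by omega), h4 _ (by omega), hdeg _ (by omega)]
      field_simp
      ring
    · rw [coeff_X_mul, h2, h3, h4 _ (by omega), hdeg _ (by omega)]
      field_simp
      ring
    · obtain ⟨j, rfl⟩ : ∃ k, j = k + 1 := ⟨j - 1, by omega⟩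
      rw [coeff_X_mul, h4 j (by omega), h1 (j + 1) (by omega), h4 (j + 1) (by omega),
        hdeg _ (by omega)]
      ring

end Poly

variable {V : Type*} [AddCommGroup V] [Module ℂ V]

namespace IsLeonardRep

variable {p : Params} {A B : Module.End ℂ V} {v vs : Basis (Fin (p.n + 1)) ℂ V}

lemma repr_X (h : p.IsLeonardRep A B v vs) (i j : Fin (p.n + 1)) :
    vs.repr (p.opX A B (vs j)) i = p.ρ⁻¹ * ((p.q * p.θs i - p.q⁻¹ * p.θs j) *
      vs.repr (A (vs j)) i + p.ω / (p.q - p.q⁻¹) * vs.repr (vs j) i) := by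
  simp only [opX, qComm, LinearMap.sub_apply, LinearMap.smul_apply, Module.End.mul_apply, map_sub,
    map_smul, h.eigs, LinearMap.add_apply, map_add, Finsupp.sub_apply, Finsupp.add_apply,
    Finsupp.smul_apply, smul_eq_mul, h.repr_B, Module.End.one_apply]
  ring

/-- Both sides are supported on the coordinates 0 and 1. The value of a₁ matches coordinate 1, and
coordinate 0 is `entry_zero`. -/
lemma A_lowest (h : p.IsLeonardRep A B v vs) :
    A (vs 0) = p.a0 • vs 0 + p.a1 • p.opX A B (vs 0) := by
  have hq := h.q_ne
  have hb := h.b_ne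
  have hbs := h.bs_ne
  have hcs := h.cs_ne
  have hN : p.q ^ p.n ≠ 0 := pow_ne_zero _ hq
  have h6 := h.q_pow_sub_one_ne (k := 2) (by norm_num)
  have h7 := h.q_sq_add_one_ne
  have hk : p.q ^ 2 - (p.q ^ 2)⁻¹ = (p.q ^ 2 - 1) * (p.q ^ 2 + 1) / p.q ^ 2 := by
    field_simp
    ring
  have hc : p.c = p.bs * p.cs / p.b := by
    have := h.bc_eq
    field_simp
    rw [mul_comm, this]
  refine vs.ext_elem fun i => ?_
  simp only [map_add, map_smul, Finsupp.add_apply, Finsupp.smul_apply, smul_eq_mul, h.repr_X]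
  by_cases hi0 : i = 0
  · subst hi0
    have h1 := h.entry_zero
    have h5 : p.q - p.q⁻¹ = (p.q ^ 2 - 1) / p.q := by field_simp
    simp only [Basis.repr_self, Finsupp.single_eq_same, a0, a1, ρ, ω, θs, t, ts, d, N_pow, hc,
      Fin.val_zero, mul_zero, pow_zero, hk, h5] at h1 ⊢
    generalize vs.repr (A (vs 0)) 0 = a at *
    generalize p.q ^ p.n = N at *
    generalize p.z = z at *
    field_simp at h1 ⊢
    linear_combination p.q * h1
  · rw [Basis.repr_self, Finsupp.single_eq_of_ne hi0]
    by_cases hi1 : (i : ℕ) = 1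
    · simp only [a1, ρ, θs, hc, hk, hi1, Fin.val_zero, mul_zero, pow_zero]
      generalize vs.repr (A (vs 0)) i = a at *
      field_simp
      ring
    · have : (i : ℕ) ≠ 0 := fun h0 => hi0 (Fin.ext h0)
      rw [h.entry_eq_zero (i := i) (j := 0) (by simp; omega)]
      simp

open Polynomial in
-- The recursion defining `polyA` and `polyB` on powers of X is the one that the commutation
-- relations impose on the vectors X^kΩ. Working in ℂ[X] rather than in V means that no independence
-- of these vectors is required.
lemma apply_aeval (h : p.IsLeonardRep A B v vs) (f : ℂ[X]) :
    A (aeval (p.opX A B) f (vs 0)) = aeval (p.opX A B) (p.polyA f) (vs 0) ∧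
      B (aeval (p.opX A B) f (vs 0)) = aeval (p.opX A B) (p.polyB f) (vs 0) := by
  have hC : ∀ (a : ℂ) (g : ℂ[X]) (x : V),
      aeval (p.opX A B) (C a * g) x = a • aeval (p.opX A B) g x := by
    intro a g x
    rw [← smul_eq_C_mul, map_smul, LinearMap.smul_apply]
  have hX : ∀ (g : ℂ[X]) (x : V),
      aeval (p.opX A B) (X * g) x = p.opX A B (aeval (p.opX A B) g x) := by
    intro g x
    rw [map_mul, aeval_X, Module.End.mul_apply]
  have key : ∀ k : ℕ, A (aeval (p.opX A B) (X ^ k : ℂ[X]) (vs 0)) =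
        aeval (p.opX A B) (p.polyA (X ^ k)) (vs 0) ∧
      B (aeval (p.opX A B) (X ^ k : ℂ[X]) (vs 0)) =
        aeval (p.opX A B) (p.polyB (X ^ k)) (vs 0) := by
    intro k
    induction k with
    | zero =>
      rw [pow_zero, polyA_one, polyB_one]
      simp [h.A_lowest, h.eigs, Algebra.algebraMap_eq_smul_one]
    | succ k ih =>
      have hA := LinearMap.congr_fun h.A_mul_X (aeval (p.opX A B) (X ^ k : ℂ[X]) (vs 0))
      have hB := LinearMap.congr_fun h.B_mul_X (aeval (p.opX A B) (X ^ k : ℂ[X]) (vs 0))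
      simp only [Module.End.mul_apply, LinearMap.sub_apply, LinearMap.add_apply,
        LinearMap.smul_apply, Module.End.one_apply] at hA hB
      rw [pow_succ', polyA_X_mul, polyB_X_mul, hX, hA, hB, ih.1, ih.2]
      simp only [map_sub, map_add, LinearMap.sub_apply, LinearMap.add_apply, hC, hX, and_self]
  induction f using Polynomial.induction_on' with
  | add f g hf hg => simp only [map_add, LinearMap.add_apply, hf, hg, and_self]
  | monomial k a =>
    rw [← C_mul_X_pow_eq_monomial, polyA_C_mul, polyB_C_mul, hC, map_smul, map_smul,
      (key k).1, (key k).2, hC, hC]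
    exact ⟨rfl, rfl⟩

end IsLeonardRep

end Params

/-! ### A triangularizing basis of polynomials for the action of A*. -/

namespace Params

open Polynomial

/-- The points of the spectrum of `X`. -/
def xk (p : Params) (k : ℕ) : ℂ := p.xval (p.ζ ^ 2 / p.q ^ p.n * p.q ^ (2 * k))

/-- The product of the first `k` linear factors of the characteristic polynomial of `X`. -/
def charFactor (p : Params) (k : ℕ) : ℂ[X] := ∏ i ∈ Finset.range k, (X - C (p.xk i))

/-- The raising, diagonal and lowering coefficients of `polyA` in the basis `charFactor`. -/
def diagA (p : Params) (k : ℕ) : ℂ :=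
  (p.q ^ (2 * k))⁻¹ * (p.a0 + p.a1 * p.xk 0
    - p.cs * (p.q + p.q⁻¹) * (1 - (p.q ^ (2 * k))⁻¹) * p.q ^ p.n / p.ζ ^ 2)

def lowerA (p : Params) (k : ℕ) : ℂ :=
  p.q ^ 3 * p.cs / ((p.ζ ^ 2 / p.q ^ p.n) ^ 2 * (p.q ^ 2 - (p.q ^ 2)⁻¹)) * (p.q ^ (4 * k))⁻¹ *
    (1 - (p.q ^ (2 * k))⁻¹) * (1 - p.q ^ (2 * k) / (p.q * p.q ^ p.n) ^ 2) *
    (1 + p.ζ ^ 2 * p.q ^ p.n * p.b / p.cs * p.q ^ (2 * k) / p.q) *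
    (1 + p.ζ ^ 2 * p.c / (p.q ^ p.n * p.cs) * p.q ^ (2 * k) / p.q)

namespace IsLeonardRep

variable {V : Type*} [AddCommGroup V] [Module ℂ V]
variable {p : Params} {A B : Module.End ℂ V} {v vs : Basis (Fin (p.n + 1)) ℂ V}

/-- Write G_k for `charFactor k`. Expanding `polyA` on G_{k+1} = (X - x_k)G_k, this matches the
coefficient of G_{k+1}. -/
lemma diagA_succ (h : p.IsLeonardRep A B v vs) (k : ℕ) :
    p.diagA (k + 1) = (p.q ^ 2)⁻¹ * ((p.q ^ (2 * k))⁻¹ * p.a1 * p.xk (k + 1) + p.diagA k)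
      - p.xk k * ((p.q ^ (2 * k))⁻¹ * p.a1) := by
  have hq := h.q_ne
  have hζ := h.ζ_ne
  have hN : p.q ^ p.n ≠ 0 := pow_ne_zero _ hq
  have hQ : p.q ^ (2 * k) ≠ 0 := pow_ne_zero _ hq
  have h6 := h.q_pow_sub_one_ne (k := 2) (by norm_num)
  have h7 := h.q_sq_add_one_ne
  have hk : p.q ^ 2 - (p.q ^ 2)⁻¹ = (p.q ^ 2 - 1) * (p.q ^ 2 + 1) / p.q ^ 2 := by
    field_simp
    ring
  have e1 : p.q ^ (2 * (k + 1)) = p.q ^ 2 * p.q ^ (2 * k) := by ring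
  simp only [diagA, a1, xk, xval, hk, e1]
  generalize p.a0 = a at *
  generalize p.q ^ (2 * k) = Q at *
  generalize p.q ^ p.n = N at *
  simp only [mul_zero, pow_zero]
  field_simp
  ring

/-- The coefficient of G_k in `polyA` G_{k+1}. -/
lemma lowerA_succ (h : p.IsLeonardRep A B v vs) (k : ℕ) :
    p.lowerA (k + 1) = (p.q ^ 2)⁻¹ * (p.diagA k * p.xk k + p.lowerA k) - p.q⁻¹ * p.θs k
      - p.q⁻¹ * p.η / p.ρ - p.xk k * p.diagA k := by
  have hq := h.q_ne
  have hζ := h.ζ_ne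
  have hb := h.b_ne
  have hbs := h.bs_ne
  have hcs := h.cs_ne
  have hc : p.c = p.bs * p.cs / p.b := by
    have := h.bc_eq
    field_simp
    rw [mul_comm, this]
  have hN : p.q ^ p.n ≠ 0 := pow_ne_zero _ hq
  have hQ : p.q ^ (2 * k) ≠ 0 := pow_ne_zero _ hq
  have h6 := h.q_pow_sub_one_ne (k := 2) (by norm_num)
  have h7 := h.q_sq_add_one_ne
  have hk : p.q ^ 2 - (p.q ^ 2)⁻¹ = (p.q ^ 2 - 1) * (p.q ^ 2 + 1) / p.q ^ 2 := by
    field_simp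
    ring
  have hk' : p.q + p.q⁻¹ = (p.q ^ 2 + 1) / p.q := by field_simp
  have e1 : p.q ^ (2 * (k + 1)) = p.q ^ 2 * p.q ^ (2 * k) := by ring
  have e3 : p.q ^ (4 * k) = (p.q ^ (2 * k)) ^ 2 := by ring
  have e2 : p.q ^ (4 * (k + 1)) = p.q ^ 4 * (p.q ^ (2 * k)) ^ 2 := by ring
  simp only [diagA, lowerA, a0, a1, xk, xval, η, ρ, t, ts, z, d, θs, N_pow, hk, hk', e1, e2, e3, hc,
    mul_zero, pow_zero]
  generalize p.q ^ (2 * k) = Q at *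
  generalize p.q ^ p.n = N at *
  field_simp
  ring

/-- The coefficient of G_k in `polyB` G_{k+1}: the same lowering coefficient must satisfy a second
recursion. -/
lemma lowerA_succ' (h : p.IsLeonardRep A B v vs) (k : ℕ) :
    p.q⁻¹ * (p.ζ ^ 2 / p.q ^ p.n * (p.q ^ 2 * p.q ^ (2 * k))) * p.lowerA (k + 1) =
      p.q ^ 2 * (p.θs k * p.xk k + p.q⁻¹ * (p.ζ ^ 2 / p.q ^ p.n * p.q ^ (2 * k)) * p.lowerA k)
        + p.q * p.diagA k + p.q * p.ηs / p.ρ - p.xk k * p.θs k := by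
  have hq := h.q_ne
  have hζ := h.ζ_ne
  have hb := h.b_ne
  have hbs := h.bs_ne
  have hcs := h.cs_ne
  have hc : p.c = p.bs * p.cs / p.b := by
    have := h.bc_eq
    field_simp
    rw [mul_comm, this]
  have hN : p.q ^ p.n ≠ 0 := pow_ne_zero _ hq
  have hQ : p.q ^ (2 * k) ≠ 0 := pow_ne_zero _ hq
  have h6 := h.q_pow_sub_one_ne (k := 2) (by norm_num)
  have h7 := h.q_sq_add_one_ne
  have hk : p.q ^ 2 - (p.q ^ 2)⁻¹ = (p.q ^ 2 - 1) * (p.q ^ 2 + 1) / p.q ^ 2 := by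
    field_simp
    ring
  have hk' : p.q + p.q⁻¹ = (p.q ^ 2 + 1) / p.q := by field_simp
  have e1 : p.q ^ (2 * (k + 1)) = p.q ^ 2 * p.q ^ (2 * k) := by ring
  have e3 : p.q ^ (4 * k) = (p.q ^ (2 * k)) ^ 2 := by ring
  have e2 : p.q ^ (4 * (k + 1)) = p.q ^ 4 * (p.q ^ (2 * k)) ^ 2 := by ring
  simp only [diagA, lowerA, a0, a1, xk, xval, ηs, ρ, t, ts, z, d, θs, N_pow, hk, hk', e1, e2, e3,
    hc, mul_zero, pow_zero]
  generalize p.q ^ (2 * k) = Q at *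
  generalize p.q ^ p.n = N at *
  field_simp
  ring

/-- Multiplying by one more linear factor could create a component two steps below. These two
scalars multiply it for `polyA` and `polyB`; they vanish because consecutive points of the spectrum
of X differ by w → q²w. -/
lemma lower_compat (h : p.IsLeonardRep A B v vs) (k : ℕ) :
    (p.q ^ 2)⁻¹ * p.xk k - p.q⁻¹ * (p.q⁻¹ * (p.ζ ^ 2 / p.q ^ p.n * p.q ^ (2 * (k + 1))))
      - p.xk (k + 1) = 0 ∧
    p.q ^ 2 * p.xk k * (p.q⁻¹ * (p.ζ ^ 2 / p.q ^ p.n * p.q ^ (2 * (k + 1)))) + p.q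
      - p.xk (k + 1) * (p.q⁻¹ * (p.ζ ^ 2 / p.q ^ p.n * p.q ^ (2 * (k + 1)))) = 0 := by
  have hq := h.q_ne
  have hζ := h.ζ_ne
  have hN : p.q ^ p.n ≠ 0 := pow_ne_zero _ hq
  have hQ : p.q ^ (2 * k) ≠ 0 := pow_ne_zero _ hq
  have h6 := h.q_pow_sub_one_ne (k := 2) (by norm_num)
  have h7 := h.q_sq_add_one_ne
  have hk : p.q ^ 2 - (p.q ^ 2)⁻¹ = (p.q ^ 2 - 1) * (p.q ^ 2 + 1) / p.q ^ 2 := by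
    field_simp
    ring
  have e1 : p.q ^ (2 * (k + 1)) = p.q ^ 2 * p.q ^ (2 * k) := by ring
  simp only [xk, xval, hk, e1]
  generalize p.q ^ (2 * k) = Q at *
  generalize p.q ^ p.n = N at *
  constructor
  · field_simp
    ring
  · field_simp
    ring

lemma θs_succ (h : p.IsLeonardRep A B v vs) (k : ℕ) :
    p.θs (k + 1) = p.q ^ 2 * p.θs k + p.q * ((p.q ^ (2 * k))⁻¹ * p.a1) := by
  have hq := h.q_ne
  have hQ : p.q ^ (2 * k) ≠ 0 := pow_ne_zero _ hq
  have e1 : p.q ^ (2 * (k + 1)) = p.q ^ 2 * p.q ^ (2 * k) := by ring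
  simp only [θs, a1, e1]
  field_simp
  ring

/-- The factor 1 - q^{2k}/q^{2(n+1)} is what closes the chain at F = `charFactor (n + 1)`, making
F(X)Ω a vector on which A* acts by θ*_{n+1}. -/
lemma lowerA_top (h : p.IsLeonardRep A B v vs) : p.lowerA (p.n + 1) = 0 := by
  have hq := h.q_ne
  have : p.q ^ (2 * (p.n + 1)) = (p.q * p.q ^ p.n) ^ 2 := by ring
  simp [lowerA, this, hq]

/-- In the basis `charFactor`, `polyA` is tridiagonal and `polyB` is bidiagonal. -/
lemma poly_charFactor (h : p.IsLeonardRep A B v vs) (k : ℕ) :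
    p.polyA (p.charFactor k) = C ((p.q ^ (2 * k))⁻¹ * p.a1) * p.charFactor (k + 1)
        + C (p.diagA k) * p.charFactor k + C (p.lowerA k) * p.charFactor (k - 1) ∧
      p.polyB (p.charFactor k) = C (p.θs k) * p.charFactor k
        + C (p.q⁻¹ * (p.ζ ^ 2 / p.q ^ p.n * p.q ^ (2 * k)) * p.lowerA k)
          * p.charFactor (k - 1) := by
  have hq := h.q_ne
  have hG : ∀ k, p.charFactor (k + 1) = (X - C (p.xk k)) * p.charFactor k := fun k => by
    rw [charFactor, Finset.prod_range_succ, mul_comm, charFactor]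
  have hl0 : p.lowerA 0 = 0 := by simp [lowerA]
  induction k with
  | zero =>
    have : p.charFactor 0 = 1 := by simp [charFactor]
    rw [hG 0, hl0, this, polyA_one, polyB_one]
    simp only [diagA, mul_zero, pow_zero, sub_self, inv_one, mul_one, one_mul, zero_div, sub_zero,
      map_zero, zero_mul, add_zero, map_add, map_mul, and_true]
    ring
  | succ k ih =>
    have e0 : (p.q ^ (2 * (k + 1)))⁻¹ = (p.q ^ 2)⁻¹ * (p.q ^ (2 * k))⁻¹ := by
      rw [← mul_inv, ← pow_add]; congr 2; ring
    have e1 : p.q ^ (2 * (k + 1)) = p.q ^ 2 * p.q ^ (2 * k) := by ring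
    have hA := congrArg (C : ℂ → ℂ[X]) (h.diagA_succ k)
    have hA' := congrArg (C : ℂ → ℂ[X]) (h.lowerA_succ k)
    have hB' := congrArg (C : ℂ → ℂ[X]) (h.lowerA_succ' k)
    have hB := congrArg (C : ℂ → ℂ[X]) (h.θs_succ k)
    -- For k = 0 truncated subtraction turns the lower neighbour into `charFactor 0`; its
    -- coefficient `lowerA 0` is zero, so this case is treated separately.
    rcases k with _ | k
    · rw [hG 0, polyA_X_sub_C_mul, polyB_X_sub_C_mul, ih.1, ih.2, hG 1, hG 0, hl0, e0, e1]
      simp only [hl0, map_add, map_sub, map_mul, map_zero, mul_zero, zero_mul, add_zero,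
        pow_zero, inv_one, zero_add, Nat.sub_self, mul_one, one_mul] at hA hA' hB hB' ⊢
      constructor
      · linear_combination (-(p.charFactor 0 * (X - C (p.xk 0)))) * hA - p.charFactor 0 * hA'
      · linear_combination (-(p.charFactor 0 * (X - C (p.xk 0)))) * hB - p.charFactor 0 * hB'
    · obtain ⟨hc1, hc2⟩ := h.lower_compat k
      have hc1 := congrArg (C : ℂ → ℂ[X]) hc1
      have hc2 := congrArg (C : ℂ → ℂ[X]) hc2
      rw [hG (k + 1), polyA_X_sub_C_mul, polyB_X_sub_C_mul, ih.1, ih.2, hG (k + 2), hG (k + 1),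
        Nat.add_sub_cancel, Nat.add_sub_cancel, hG k, e0, e1]
      simp only [map_add, map_sub, map_mul, map_zero] at hA hA' hB hB' hc1 hc2 ⊢
      generalize p.charFactor k = g at *
      generalize p.xk (k + 1) = x1 at *
      generalize p.xk k = x0 at *
      constructor
      · linear_combination (-(g * (X - C x0) * (X - C x1))) * hA - g * (X - C x0) * hA'
          + C (p.lowerA (k + 1)) * g * hc1
      · linear_combination (-(g * (X - C x0) * (X - C x1))) * hB - g * (X - C x0) * hB'
          + C (p.lowerA (k + 1)) * g * hc2

lemma B_charFactor_top (h : p.IsLeonardRep A B v vs) :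
    B (aeval (p.opX A B) (p.charFactor (p.n + 1)) (vs 0)) =
      p.θs (p.n + 1) • aeval (p.opX A B) (p.charFactor (p.n + 1)) (vs 0) := by
  rw [(h.apply_aeval _).2, (h.poly_charFactor _).2, h.lowerA_top, mul_zero, map_zero, zero_mul,
    add_zero, ← smul_eq_C_mul, map_smul, LinearMap.smul_apply]

end IsLeonardRep

end Params

/-! ### Two symmetries of the data, and the annihilation of X by F. -/

namespace Params

open Polynomial

/-- The parameters for the reversed eigenbasis of `A*`. -/
def rev (p : Params) : Params :=
  { p with bs := p.cs * (p.q ^ (2 * p.n))⁻¹, cs := p.bs * p.q ^ (2 * p.n) }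

/-- The parameters for the roles of `A` and `A*` exchanged, with `q` replaced by `q⁻¹`. -/
def swap (p : Params) : Params :=
  { p with r := p.r⁻¹, b := p.cs, c := p.bs, bs := p.c, cs := p.b }

lemma swap_q (p : Params) : p.swap.q = p.q⁻¹ := inv_pow p.r 2

lemma swap_θ (p : Params) (k : ℕ) : p.swap.θ k = p.θs k := by
  rw [θ, swap_q, inv_pow, inv_inv, θs, add_comm]; rfl

lemma swap_θs (p : Params) (k : ℕ) : p.swap.θs k = p.θ k := by
  rw [θs, swap_q, inv_pow, inv_inv, θ, add_comm]; rfl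

lemma swap_t (p : Params) : p.swap.t = p.ts := by
  rw [t, swap_q, inv_pow, inv_inv, ts, add_comm]; rfl

lemma swap_ts (p : Params) : p.swap.ts = p.t := by
  rw [ts, swap_q, inv_pow, inv_inv, t, add_comm]; rfl

lemma swap_d (p : Params) : p.swap.d = p.d := by
  rw [d, swap_q, inv_pow, inv_inv, d, add_comm]; rfl

lemma swap_ρ (p : Params) (hbc : p.b * p.c = p.bs * p.cs) : p.swap.ρ = p.ρ := by
  rw [ρ, swap_q, ρ, hbc, show p.swap.b * p.swap.c = p.cs * p.bs from rfl, inv_pow, inv_inv]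
  ring

lemma swap_ω (p : Params) (hbc : p.b * p.c = p.bs * p.cs) : p.swap.ω = p.ω := by
  rw [ω, swap_q, swap_t, swap_ts, swap_d, ω, hbc, show p.swap.b * p.swap.c = p.cs * p.bs from rfl,
    show p.swap.z = p.z from rfl, inv_inv]
  ring

lemma swap_η (p : Params) : p.swap.η = p.ηs := by
  rw [η, swap_q, swap_t, swap_ts, swap_d, ηs, show p.swap.b * p.swap.c = p.cs * p.bs from rfl,
    show p.swap.z = p.z from rfl, inv_pow, inv_inv, inv_inv]
  ring

lemma swap_ηs (p : Params) : p.swap.ηs = p.η := by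
  rw [ηs, swap_q, swap_t, swap_ts, swap_d, η, show p.swap.bs * p.swap.cs = p.c * p.b from rfl,
    show p.swap.z = p.z from rfl, inv_pow, inv_inv, inv_inv]
  ring

lemma rev_ts (p : Params) (hq : p.q ≠ 0) : p.rev.ts = p.ts := by
  change p.cs * (p.q ^ (2 * p.n))⁻¹ * p.q ^ p.n + p.bs * p.q ^ (2 * p.n) * (p.q ^ p.n)⁻¹ = p.ts
  have : p.q ^ (2 * p.n) = (p.q ^ p.n) ^ 2 := by ring
  rw [ts, this]
  field_simp
  ring

lemma rev_bs_mul_cs (p : Params) (hq : p.q ≠ 0) : p.rev.bs * p.rev.cs = p.bs * p.cs := by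
  change p.cs * (p.q ^ (2 * p.n))⁻¹ * (p.bs * p.q ^ (2 * p.n)) = _
  field_simp

lemma rev_ω (p : Params) (hq : p.q ≠ 0) : p.rev.ω = p.ω := by
  rw [ω, rev_ts p hq]; rfl

lemma rev_η (p : Params) (hq : p.q ≠ 0) : p.rev.η = p.η := by
  rw [η, rev_ts p hq]; rfl

lemma rev_ηs (p : Params) (hq : p.q ≠ 0) : p.rev.ηs = p.ηs := by
  rw [ηs, rev_ts p hq, rev_bs_mul_cs p hq]; rfl

lemma rev_θs (p : Params) (hq : p.q ≠ 0) (k : ℕ) (hk : k ≤ p.n) :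
    p.rev.θs k = p.θs (p.n - k) := by
  change p.cs * (p.q ^ (2 * p.n))⁻¹ * p.q ^ (2 * k) + p.bs * p.q ^ (2 * p.n) * (p.q ^ (2 * k))⁻¹ = _
  have : p.q ^ (2 * p.n) = p.q ^ (2 * (p.n - k)) * p.q ^ (2 * k) := by
    rw [← pow_add]; congr 1; omega
  rw [θs, this]
  field_simp
  ring

namespace IsLeonardRep

variable {V : Type*} [AddCommGroup V] [Module ℂ V]
variable {p : Params} {A B : Module.End ℂ V} {v vs : Basis (Fin (p.n + 1)) ℂ V}

/-- Listing the eigenvalues of A* backwards exchanges b* and c* up to powers of q and leaves the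
structure constants unchanged. It gives access to the vector |θ*_n⟩ as a second lowest vector. -/
lemma rev (h : p.IsLeonardRep A B v vs) :
    p.rev.IsLeonardRep A B v (vs.reindex (Fin.revPerm : Fin (p.n + 1) ≃ Fin (p.n + 1))) := by
  have hq := h.q_ne
  have hval : ∀ N : Fin (p.n + 1), p.rev.θs N = p.θs (Fin.rev N) := fun N => by
    rw [p.rev_θs hq N (by omega), Fin.val_rev]
    congr 1
    omega
  have heig : ∀ N : Fin (p.n + 1), B (vs.reindex Fin.revPerm N) =
      p.rev.θs N • vs.reindex Fin.revPerm N := fun N => by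
    rw [hval, Basis.reindex_apply]
    exact h.eigs _
  have hinj : ∀ N N' : Fin (p.n + 1), p.rev.θs N = p.rev.θs N' → N = N' := fun N N' hN => by
    rw [hval, hval] at hN
    exact Fin.rev_injective (h.θs_inj _ _ hN)
  exact
    { r_ne := h.r_ne
      q_pow_ne := h.q_pow_ne
      ζ_ne := h.ζ_ne
      b_ne := h.b_ne
      c_ne := h.c_ne
      bs_ne := mul_ne_zero h.cs_ne (inv_ne_zero (pow_ne_zero _ hq))
      cs_ne := mul_ne_zero h.bs_ne (pow_ne_zero _ hq)
      bc_eq := (p.rev_bs_mul_cs hq).symm ▸ h.bc_eq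
      aw1 := by rw [p.rev_ω hq, p.rev_η hq]; exact h.aw1
      aw2 := by rw [p.rev_ω hq, p.rev_ηs hq]; exact h.aw2
      irr := h.irr
      eig := h.eig
      eigs := heig
      θ_inj := h.θ_inj
      θs_inj := hinj }

lemma swap (h : p.IsLeonardRep A B v vs) : p.swap.IsLeonardRep B A vs v where
  r_ne := inv_ne_zero h.r_ne
  q_pow_ne := fun k hk => by
    rw [swap_q, inv_pow, ne_eq, inv_eq_one]; exact h.q_pow_ne k hk
  ζ_ne := h.ζ_ne
  b_ne := h.cs_ne
  c_ne := h.bs_ne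
  bs_ne := h.c_ne
  cs_ne := h.b_ne
  bc_eq := by
    have := h.bc_eq
    change p.cs * p.bs = p.c * p.b
    rw [mul_comm, ← this, mul_comm]
  aw1 := by
    have := h.aw2
    rw [swap_q, p.swap_ρ h.bc_eq, p.swap_ω h.bc_eq, swap_η, ← this]
    simp only [qComm, mul_sub, sub_mul, smul_mul_assoc, mul_smul_comm, mul_assoc, smul_sub,
      smul_smul, inv_inv]
    match_scalars <;> ring
  aw2 := by
    have := h.aw1
    rw [swap_q, p.swap_ρ h.bc_eq, p.swap_ω h.bc_eq, swap_ηs, ← this]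
    simp only [qComm, mul_sub, sub_mul, smul_mul_assoc, mul_smul_comm, mul_assoc, smul_sub,
      smul_smul, inv_inv]
    match_scalars <;> ring
  irr := fun W hB hA => h.irr W hA hB
  eig := fun M => by rw [swap_θ]; exact h.eigs M
  eigs := fun M => by rw [swap_θs]; exact h.eig M
  θ_inj := fun M M' hM => by rw [swap_θ, swap_θ] at hM; exact h.θs_inj M M' hM
  θs_inj := fun M M' hM => by rw [swap_θs, swap_θs] at hM; exact h.θ_inj M M' hM

/-- [A, A*]_{q⁻¹} = -[A*, A]_q, and q - q⁻¹ changes sign as well. -/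
lemma opX_swap (h : p.IsLeonardRep A B v vs) : p.swap.opX B A = -p.opX A B := by
  have e : p.ω / (p.q⁻¹ - p.q) = -(p.ω / (p.q - p.q⁻¹)) := by
    rw [← neg_sub, div_neg]
  rw [opX, opX, swap_q, p.swap_ρ h.bc_eq, p.swap_ω h.bc_eq, qComm, qComm, inv_inv, e]
  module

lemma opX_rev (h : p.IsLeonardRep A B v vs) : p.rev.opX A B = p.opX A B := by
  rw [opX, p.rev_ω h.q_ne]; rfl

/-- Ω is cyclic for X: the vectors f(X)Ω form a subspace stable under A and A*, and irreducibility
applies. -/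
lemma exists_aeval_eq (h : p.IsLeonardRep A B v vs) (x : V) :
    ∃ f : ℂ[X], aeval (p.opX A B) f (vs 0) = x := by
  let W : Submodule ℂ V :=
    LinearMap.range ((LinearMap.applyₗ (vs 0)).comp (aeval (p.opX A B)).toLinearMap)
  have hmem : ∀ f : ℂ[X], aeval (p.opX A B) f (vs 0) ∈ W := fun f => ⟨f, rfl⟩
  have hW : W = ⊥ ∨ W = ⊤ := by
    refine h.irr W ?_ ?_
    · rintro _ ⟨f, rfl⟩
      change A (aeval (p.opX A B) f (vs 0)) ∈ W
      rw [(h.apply_aeval f).1]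
      exact hmem _
    · rintro _ ⟨f, rfl⟩
      change B (aeval (p.opX A B) f (vs 0)) ∈ W
      rw [(h.apply_aeval f).2]
      exact hmem _
  rcases hW with hW | hW
  · have h1 := hmem 1
    rw [hW, Submodule.mem_bot] at h1
    exact absurd (by simpa using h1) (vs.ne_zero 0)
  · have : x ∈ W := hW ▸ Submodule.mem_top
    exact this

lemma aeval_eq_zero (h : p.IsLeonardRep A B v vs) {f : ℂ[X]}
    (hf : aeval (p.opX A B) f (vs 0) = 0) : aeval (p.opX A B) f = 0 := by
  ext x
  obtain ⟨g, rfl⟩ := h.exists_aeval_eq x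
  rw [← Module.End.mul_apply, ← map_mul, mul_comm, map_mul, Module.End.mul_apply, hf, map_zero,
    LinearMap.zero_apply]

/-- If F(X) ≠ 0 then, Ω being cyclic, F(X)Ω is an eigenvector of A* for θ*_{n+1}. This value must
equal some θ*_i with i ≤ n, which forces the stated coincidence. The hypothesis concerns the
operator and not the vector, so that it can be used with either end of the eigenbasis. -/
lemma resonance (h : p.IsLeonardRep A B v vs)
    (h0 : aeval (p.opX A B) (p.charFactor (p.n + 1)) ≠ 0) :
    ∃ i : ℕ, p.bs * p.q ^ (2 * (p.n + 1 + i)) = p.cs := by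
  have h1 : aeval (p.opX A B) (p.charFactor (p.n + 1)) (vs 0) ≠ 0 :=
    fun h2 => h0 (h.aeval_eq_zero h2)
  have h2 := h.B_charFactor_top
  have hq := h.q_ne
  set g := aeval (p.opX A B) (p.charFactor (p.n + 1)) (vs 0) with hg
  obtain ⟨i, hi⟩ : ∃ i, vs.repr g i ≠ 0 := by
    by_contra! hall
    exact h1 (vs.ext_elem fun i => by simp [hall i])
  refine ⟨i, ?_⟩
  have h3 := h.repr_B g i
  rw [h2, map_smul, Finsupp.smul_apply, smul_eq_mul] at h3
  have h4 := mul_right_cancel₀ hi h3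
  have h5 : p.q ^ (2 * (p.n + 1)) = p.q ^ (2 * (p.n + 1 - (i : ℕ))) * p.q ^ (2 * (i : ℕ)) := by
    rw [← pow_add]; congr 1; omega
  have h6 : p.q ^ (2 * (p.n + 1 - (i : ℕ))) - 1 ≠ 0 := h.q_pow_sub_one_ne (by omega)
  have h7 : p.q ^ (2 * (p.n + 1 + (i : ℕ))) =
      p.q ^ (2 * (p.n + 1 - (i : ℕ))) * (p.q ^ (2 * (i : ℕ))) ^ 2 := by
    rw [← pow_mul, ← pow_add]; congr 1; omega
  simp only [θs, h5] at h4
  rw [h7]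
  have hQ : p.q ^ (2 * (i : ℕ)) ≠ 0 := pow_ne_zero _ hq
  have hR : p.q ^ (2 * (p.n + 1 - (i : ℕ))) ≠ 0 := pow_ne_zero _ hq
  generalize p.q ^ (2 * (p.n + 1 - (i : ℕ))) = R at *
  generalize p.q ^ (2 * (i : ℕ)) = Q at *
  field_simp at h4
  refine mul_left_cancel₀ h6 ?_
  linear_combination h4

/-- `X` is annihilated by its characteristic polynomial. -/
lemma aeval_charFactor (h : p.IsLeonardRep A B v vs) :
    aeval (p.opX A B) (p.charFactor (p.n + 1)) = 0 := by
  by_contra h0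
  obtain ⟨i, hi⟩ := h.resonance h0
  -- The reversed eigenbasis yields a resonance in the opposite direction. Together the two give
  -- q^{2(i+j+2)} = 1.
  obtain ⟨j, hj⟩ := h.rev.resonance (by rw [h.opX_rev]; exact h0)
  change p.cs * (p.q ^ (2 * p.n))⁻¹ * p.q ^ (2 * (p.n + 1 + j)) = p.bs * p.q ^ (2 * p.n) at hj
  have hq := h.q_ne
  have hbs := h.bs_ne
  rw [← hi] at hj
  have h1 : p.q ^ (2 * (i + j + 2)) - 1 ≠ 0 := h.q_pow_sub_one_ne (by omega)
  apply h1
  have e1 : p.q ^ (2 * (p.n + 1 + i)) = p.q ^ (2 * p.n) * p.q ^ (2 * (i + 1)) := by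
    rw [← pow_add]; congr 1; ring
  have e2 : p.q ^ (2 * (p.n + 1 + j)) = p.q ^ (2 * p.n) * p.q ^ (2 * (j + 1)) := by
    rw [← pow_add]; congr 1; ring
  have e3 : p.q ^ (2 * (i + j + 2)) = p.q ^ (2 * (i + 1)) * p.q ^ (2 * (j + 1)) := by
    rw [← pow_add]; congr 1; ring
  rw [e1, e2] at hj
  rw [e3]
  have hQ : p.q ^ (2 * p.n) ≠ 0 := pow_ne_zero _ hq
  field_simp at hj
  linear_combination hj

end IsLeonardRep

end Params

/-! ### The q-difference operator and the values of F. -/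

lemma br_mul_br {x y : ℂ} (hx : x ≠ 0) (hy : y ≠ 0) :
    br x * br y = x * y + (x * y)⁻¹ - (x / y + (x / y)⁻¹) := by
  simp only [br]
  field_simp
  ring

lemma br_inv (x : ℂ) : br x⁻¹ = -br x := by
  rw [br, br, inv_inv, neg_sub]

namespace Params

open Polynomial

/-- The spectral point of `X` attached to a Bethe root. -/
def rootPoint (p : Params) (u : ℂ) : ℂ := p.xval (p.q * u ^ 2)

/-- The monic polynomial whose roots are the spectral points of the Bethe roots. -/
def rootPoly (p : Params) {ι : Type*} (s : Finset ι) (u : ι → ℂ) : ℂ[X] :=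
  ∏ j ∈ s, (X - C (p.rootPoint (u j)))

/-- The coefficient of the difference operator by which `A` acts. -/
def diffCoeff (p : Params) (w : ℂ) : ℂ :=
  p.cs * (1 - p.ζ ^ 2 / p.q ^ p.n * w) * (1 - w / (p.ζ ^ 2 * p.q ^ p.n)) *
    (1 + p.q * (p.q ^ p.n) ^ 2 * p.b / p.cs * w) * (1 + p.q * p.c / p.cs * w) /
    ((p.q ^ 2 + 1) * p.q * w ^ 2 * (1 - w ^ 2))

lemma xval_sub_xval (p : Params) (w w' : ℂ) :
    p.xval w - p.xval w' =
      -(p.q ^ 2 - (p.q ^ 2)⁻¹)⁻¹ * (w + w⁻¹ - (w' + w'⁻¹)) := by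
  rw [xval, xval]; ring

namespace IsLeonardRep

variable {V : Type*} [AddCommGroup V] [Module ℂ V]
variable {p : Params} {A B : Module.End ℂ V} {v vs : Basis (Fin (p.n + 1)) ℂ V}

lemma eval_polyA_root (h : p.IsLeonardRep A B v vs) {w : ℂ} (hw : w ≠ 0) (hw2 : w ^ 2 ≠ 1)
    (f : ℂ[X]) :
    (p.polyA ((X - C (p.xval w)) * f)).eval (p.xval w) =
      p.diffCoeff w * f.eval (p.xval (p.q ^ 2 * w))
        + p.diffCoeff w⁻¹ * f.eval (p.xval (w / p.q ^ 2)) := by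
  have hq := h.q_ne
  have hζ := h.ζ_ne
  have hb := h.b_ne
  have hbs := h.bs_ne
  have hcs := h.cs_ne
  have hc : p.c = p.bs * p.cs / p.b := by
    have := h.bc_eq
    field_simp
    rw [mul_comm, this]
  have hN : p.q ^ p.n ≠ 0 := pow_ne_zero _ hq
  have h6 := h.q_pow_sub_one_ne (k := 2) (by norm_num)
  have h7 := h.q_sq_add_one_ne
  have hk : p.q ^ 2 - (p.q ^ 2)⁻¹ = (p.q ^ 2 - 1) * (p.q ^ 2 + 1) / p.q ^ 2 := by
    field_simp
    ring
  have hk' : p.q + p.q⁻¹ = (p.q ^ 2 + 1) / p.q := by field_simp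
  have hw1 : 1 - w ^ 2 ≠ 0 := sub_ne_zero.2 (Ne.symm hw2)
  have hw3 : 1 - (w⁻¹) ^ 2 = -((1 - w ^ 2) / w ^ 2) := by
    field_simp
    ring
  -- The eigenvectors of the 2 × 2 recursion have slopes E/D = qw and qw⁻¹, with eigenvalues x(q²w)
  -- and x(w/q²).
  refine (p.eval_polyA_polyB_root (Ep := p.q * w * p.diffCoeff w)
    (Em := p.q * w⁻¹ * p.diffCoeff w⁻¹) ?_ ?_ ?_ ?_ ?_ ?_ f).1
  · have : p.xval (p.q ^ 2 * w) = (p.q ^ 2)⁻¹ * p.xval w - w := by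
      simp only [xval, hk]
      field_simp
      ring
    rw [this]
    field_simp
  · have : p.xval (w / p.q ^ 2) = (p.q ^ 2)⁻¹ * p.xval w - w⁻¹ := by
      simp only [xval, hk]
      field_simp
      ring
    rw [this]
    field_simp
  · have : p.xval (p.q ^ 2 * w) = p.q ^ 2 * p.xval w + w⁻¹ := by
      simp only [xval, hk]
      field_simp
      ring
    rw [this]
    field_simp
  · have : p.xval (w / p.q ^ 2) = p.q ^ 2 * p.xval w + w := by
      simp only [xval, hk]
      field_simp
      ring
    rw [this]
    field_simp
  · simp only [diffCoeff, a0, a1, xval, η, ρ, t, ts, z, d, θs, N_pow, hk, hk', hc, hw3,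
      mul_zero, pow_zero]
    generalize p.q ^ p.n = N at *
    field_simp
    ring
  · simp only [diffCoeff, a0, a1, xval, ηs, ρ, t, ts, z, d, θs, N_pow, hk, hk', hc, hw3,
      mul_zero, pow_zero]
    generalize p.q ^ p.n = N at *
    field_simp
    ring

lemma rootPoint_sub (h : p.IsLeonardRep A B v vs) {x y : ℂ} (hx : x ≠ 0) (hy : y ≠ 0) :
    p.rootPoint x - p.rootPoint y =
      -(p.q ^ 2 - (p.q ^ 2)⁻¹)⁻¹ * (br (x / y) * br (p.q * x * y)) := by
  have hq := h.q_ne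
  rw [mul_comm (br _), br_mul_br (by positivity) (by positivity), rootPoint, rootPoint,
    xval_sub_xval]
  congr 2
  · congr 1 <;> [skip; congr 1] <;> field_simp
  · congr 1 <;> [skip; congr 1] <;> field_simp

/-- The values of the characteristic polynomial of `X`. -/
lemma eval_charFactor (h : p.IsLeonardRep A B v vs) {x : ℂ} (hx : x ≠ 0) :
    (p.charFactor (p.n + 1)).eval (p.rootPoint x) =
      (-(p.q ^ 2 - (p.q ^ 2)⁻¹)⁻¹) ^ (p.n + 1) * ∏ k ∈ Finset.range (p.n + 1),
        (br (p.r ^ (1 + 2 * (k : ℤ) - p.n) * p.ζ * x)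
          * br (p.r ^ (1 + 2 * (k : ℤ) - p.n) * p.ζ⁻¹ * x)) := by
  have hr := h.r_ne
  have hζ := h.ζ_ne
  rw [charFactor, eval_prod, Finset.prod_mul_distrib,
    ← Finset.prod_range_reflect (fun k : ℕ => br (p.r ^ (1 + 2 * (k : ℤ) - p.n) * p.ζ⁻¹ * x)),
    ← Finset.prod_mul_distrib]
  have hcard : (-(p.q ^ 2 - (p.q ^ 2)⁻¹)⁻¹) ^ (p.n + 1) =
      ∏ k ∈ Finset.range (p.n + 1), (-(p.q ^ 2 - (p.q ^ 2)⁻¹)⁻¹) := by simp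
  rw [hcard, ← Finset.prod_mul_distrib]
  refine Finset.prod_congr rfl fun k hk => ?_
  have hk' : k ≤ p.n := by simpa [Nat.lt_succ_iff] using hk
  -- Chosen so that qy² = ζ²q^{2k-n}. The difference x(x) - x(y) then gives b(qxy), with the
  -- exponent of index k, and b(x/y), with that of index n - k; hence the earlier reflection of one
  -- product.
  set y : ℂ := p.r ^ (2 * (k : ℤ) - p.n - 1) * p.ζ with hy
  have hy0 : y ≠ 0 := mul_ne_zero (zpow_ne_zero _ hr) hζ
  have e1 : p.xk k = p.rootPoint y := by
    rw [xk, rootPoint]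
    congr 1
    rw [hy, q, mul_pow, zpow_sub₀ hr, zpow_sub₀ hr, zpow_one, zpow_mul, zpow_natCast,
      zpow_natCast]
    rw [← pow_mul, ← pow_mul]
    have : p.r ^ (2:ℤ) = p.r ^ 2 := by norm_cast
    rw [this, ← pow_mul]
    field_simp
    ring
  rw [eval_sub, eval_X, eval_C, e1, h.rootPoint_sub hx hy0, mul_comm (br (x / y))]
  congr 3
  · rw [hy, show (1 + 2 * (k : ℤ) - p.n) = 2 + (2 * (k : ℤ) - p.n - 1) by ring, zpow_add₀ hr, q]
    have : p.r ^ (2:ℤ) = p.r ^ 2 := by norm_cast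
    rw [this]
    ring
  · rw [hy, Nat.add_sub_cancel, Nat.cast_sub hk',
      show (1 + 2 * ((p.n : ℤ) - k) - p.n) = -(2 * (k : ℤ) - p.n - 1) by ring, zpow_neg]
    field_simp

end IsLeonardRep

end Params

/-! ### The Bethe equations and the inhomogeneous TQ-relation. -/

namespace Params

open Polynomial

namespace IsLeonardRep

variable {V : Type*} [AddCommGroup V] [Module ℂ V]
variable {p : Params} {A B : Module.End ℂ V} {v vs : Basis (Fin (p.n + 1)) ℂ V}

lemma rootPoint_ne (h : p.IsLeonardRep A B v vs) {ε : ℤ} {u : Fin p.n → ℂ}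
    (hu : p.IsBetheSolution ε u) {i j : Fin p.n} (hij : i ≠ j) :
    p.rootPoint (u i) ≠ p.rootPoint (u j) := by
  intro h0
  apply hu.admissible i j hij
  have h1 := h.q_sq_sub_inv_ne
  rw [rootPoint, rootPoint, xval, xval, neg_inj, div_left_inj' h1] at h0
  rw [U, U, h0]

/-- The coefficients of the Bethe equations are those of the difference operator. -/
lemma bethe_coefficients (h : p.IsLeonardRep A B v vs) {x : ℂ} (hx : x ≠ 0)
    (h1 : x ^ 2 ≠ (x ^ 2)⁻¹) (h2 : br (p.q * x ^ 2) ≠ 0) :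
    let μ := br p.q * x ^ 2 / (br (x ^ 2) * (p.q ^ 2 - (p.q ^ 2)⁻¹))
    μ * (br (x ^ 2) / br (p.q * x ^ 2) * x ^ (1 : ℤ) * p.Λ1 1 x) =
        p.diffCoeff (p.q * x ^ 2)⁻¹ ∧
      μ * ((p.q ^ 2 * x ^ 3) ^ (-(1 : ℤ)) * p.Λ2 1 x) = -p.diffCoeff (p.q * x ^ 2) ∧
      μ * (p.ν 1 * (x ^ (-2 * (1 : ℤ)) * br (x ^ 2) / br p.q)) =
        -((p.q ^ (2 * p.n))⁻¹ * p.a1 * (-(p.q ^ 2 - (p.q ^ 2)⁻¹)⁻¹) ^ 2) := by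
  intro μ
  have hq := h.q_ne
  have hζ := h.ζ_ne
  have hb := h.b_ne
  have hbs := h.bs_ne
  have hcs := h.cs_ne
  have hc : p.bs = p.c * p.b / p.cs := by
    have := h.bc_eq
    field_simp
    rw [← this, mul_comm]
  have hN : p.q ^ p.n ≠ 0 := pow_ne_zero _ hq
  have h6 := h.q_pow_sub_one_ne (k := 2) (by norm_num)
  have h7 := h.q_sq_add_one_ne
  have hk : p.q ^ 2 - (p.q ^ 2)⁻¹ = (p.q ^ 2 - 1) * (p.q ^ 2 + 1) / p.q ^ 2 := by
    field_simp
    ring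
  have e1 : br p.q = (p.q ^ 2 - 1) / p.q := by
    rw [br]; field_simp
  have e2 : br (x ^ 2) = (x ^ 4 - 1) / x ^ 2 := by
    rw [br]; field_simp
  have e3 : br (p.q * x ^ 2) = (p.q ^ 2 * x ^ 4 - 1) / (p.q * x ^ 2) := by
    rw [br]; field_simp
  have h3 : x ^ 4 - 1 ≠ 0 := by
    intro h0
    apply h1
    field_simp
    linear_combination h0
  have h4 : p.q ^ 2 * x ^ 4 - 1 ≠ 0 := by
    intro h0
    rw [e3, h0, zero_div] at h2
    exact h2 rfl
  have h5 : 1 - (p.q * x ^ 2) ^ 2 = -(p.q ^ 2 * x ^ 4 - 1) := by ring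
  have h5' : 1 - ((p.q * x ^ 2)⁻¹) ^ 2 = (p.q ^ 2 * x ^ 4 - 1) / (p.q * x ^ 2) ^ 2 := by
    field_simp
  have hμ : μ = (p.q ^ 2 - 1) / p.q * x ^ 2 /
      ((x ^ 4 - 1) / x ^ 2 * ((p.q ^ 2 - 1) * (p.q ^ 2 + 1) / p.q ^ 2)) := by
    simp only [μ, e1, e2, hk]
  have hNz : p.q ^ ((p.n : ℤ) - 1) = p.q ^ p.n / p.q := by
    rw [zpow_sub₀ hq, zpow_natCast, zpow_one]
  have hN2 : p.q ^ (2 * p.n) = (p.q ^ p.n) ^ 2 := by ring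
  have hN3 : p.q ^ (1 + 2 * p.n) = p.q * (p.q ^ p.n) ^ 2 := by ring
  have z0 : ((1 : ℤ) - 1) / 2 = 0 := by norm_num
  have z1 : ((1 : ℤ) + 1) / 2 = 1 := by norm_num
  have z2 : x ^ (-2 * (1 : ℤ)) = (x ^ 2)⁻¹ := by
    rw [mul_one, zpow_neg]; norm_cast
  rw [hμ]
  refine ⟨?_, ?_, ?_⟩
  · simp only [Λ1, diffCoeff, e2, e3, h5', z0, z1, zpow_zero, zpow_one, N_pow, hc]
    generalize p.q ^ p.n = N at *
    field_simp
  · simp only [Λ2, diffCoeff, e2, e3, h5, z0, z1, zpow_zero, zpow_one, zpow_neg, N_pow, hNz, hc]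
    generalize p.q ^ p.n = N at *
    field_simp
    ring
  · simp only [ν, a1, e1, e2, hk, z2, hN2, hN3, if_true]
    generalize p.q ^ p.n = N at *
    field_simp

/-- The Bethe equation at `u i` says that the difference operator applied to the root polynomial
agrees at the `i`-th root with a multiple of the characteristic polynomial. -/
lemma eval_polyA_rootPoly (h : p.IsLeonardRep A B v vs) {u : Fin p.n → ℂ}
    (hu : p.IsBetheSolution 1 u) (i : Fin p.n) :
    (p.polyA (p.rootPoly Finset.univ u)).eval (p.rootPoint (u i)) =
      (p.q ^ (2 * p.n))⁻¹ * p.a1 * (p.charFactor (p.n + 1)).eval (p.rootPoint (u i)) := by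
  have hq := h.q_ne
  have hn := hu.ne_zero
  have hw : p.q * u i ^ 2 ≠ 0 := mul_ne_zero hq (pow_ne_zero 2 (hn i))
  have hw2 : (p.q * u i ^ 2) ^ 2 ≠ 1 := by
    intro h0
    apply hu.regular i
    rw [br, sub_eq_zero, eq_comm, inv_eq_iff_eq_inv, ← mul_eq_one_iff_eq_inv₀ hw, ← pow_two, h0]
  set κ : ℂ := -(p.q ^ 2 - (p.q ^ 2)⁻¹)⁻¹ with hκ
  set s := Finset.univ.erase i with hs
  have hsplit : p.rootPoly Finset.univ u = (X - C (p.xval (p.q * u i ^ 2))) * p.rootPoly s u :=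
    (Finset.mul_prod_erase _ _ (Finset.mem_univ i)).symm
  have hcard : s.card + 1 = p.n := by
    rw [hs, Finset.card_erase_add_one (Finset.mem_univ i), Finset.card_univ, Fintype.card_fin]
  set P : ℂ := ∏ j ∈ s, (br (u i * (u j)⁻¹) * br (p.q * u i * u j)) with hP
  have hterm : ∀ j ∈ s, br (u i * (u j)⁻¹) * br (p.q * u i * u j) ≠ 0 := by
    intro j hj h0
    have h1 := h.rootPoint_sub (hn i) (hn j)
    rw [div_eq_mul_inv, h0, mul_zero, sub_eq_zero] at h1
    exact h.rootPoint_ne hu (Finset.ne_of_mem_erase hj).symm h1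
  have hP0 : P ≠ 0 := Finset.prod_ne_zero_iff.2 hterm
  have hprod : ∀ x : ℂ, x ≠ 0 → (p.rootPoly s u).eval (p.rootPoint x) =
      κ ^ s.card * ∏ j ∈ s, (br (x / u j) * br (p.q * x * u j)) := by
    intro x hx
    rw [rootPoly, eval_prod, ← Finset.prod_const, ← Finset.prod_mul_distrib]
    refine Finset.prod_congr rfl fun j _ => ?_
    rw [eval_sub, eval_X, eval_C, h.rootPoint_sub hx (hn j)]
  have hup : p.xval (p.q ^ 2 * (p.q * u i ^ 2)) = p.rootPoint (p.q * u i) := by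
    rw [rootPoint]; congr 1; ring
  have hdn : p.xval (p.q * u i ^ 2 / p.q ^ 2) = p.rootPoint (u i / p.q) := by
    rw [rootPoint]; congr 1; field_simp
  -- Up to κ^{n-1}, the h-product times P is the reduced root polynomial at the shifted argument q
  -- u_i; below, the f-product does the same at u_i/q.
  have hh : (∏ j ∈ s, p.h (u i) (u j)) * P =
      ∏ j ∈ s, (br (p.q * u i / u j) * br (p.q * (p.q * u i) * u j)) := by
    rw [hP, ← Finset.prod_mul_distrib]
    refine Finset.prod_congr rfl fun j hj => ?_
    have h1 := mul_ne_zero_iff.1 (hterm j hj)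
    rw [← div_eq_mul_inv] at h1
    rw [Params.h, ← div_eq_mul_inv, mul_comm (br (u i / u j)),
      div_mul_cancel₀ _ (mul_ne_zero h1.2 h1.1), mul_comm]
    congr 2
    ring
  have hf : (∏ j ∈ s, p.f (u i) (u j)) * P =
      ∏ j ∈ s, (br (u i / p.q / u j) * br (p.q * (u i / p.q) * u j)) := by
    rw [hP, ← Finset.prod_mul_distrib]
    refine Finset.prod_congr rfl fun j hj => ?_
    have h1 := mul_ne_zero_iff.1 (hterm j hj)
    have e1 : br (u j / u i) = -br (u i * (u j)⁻¹) := by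
      rw [← br_inv, mul_inv, inv_inv, mul_comm, ← div_eq_mul_inv]
    have e2 : br (p.q * u j / u i) = -br (u i / p.q / u j) := by
      rw [← br_inv]
      congr 1
      field_simp
    have e3 : p.q * (u i / p.q) = u i := mul_div_cancel₀ _ hq
    rw [f, e1, e2, e3, neg_mul, neg_mul, neg_div_neg_eq,
      div_mul_cancel₀ _ (mul_ne_zero h1.1 h1.2)]
  obtain ⟨c1, c2, c3⟩ := h.bethe_coefficients (hn i) (hu.nontrivial i) (hu.regular i)
  have hE := hu.bethe i
  rw [E, ← hs, ← hP] at hE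
  rw [hsplit, rootPoint, h.eval_polyA_root hw hw2, hup, hdn, ← rootPoint,
    hprod _ (mul_ne_zero hq (hn i)), hprod _ (div_ne_zero (hn i) hq), ← hh, ← hf,
    h.eval_charFactor (hn i), ← hκ]
  rw [← hκ] at c3
  generalize (∏ k ∈ Finset.range (p.n + 1), (br (p.r ^ (1 + 2 * (k : ℤ) - p.n) * p.ζ * u i)
    * br (p.r ^ (1 + 2 * (k : ℤ) - p.n) * p.ζ⁻¹ * u i))) = G at *
  -- F has n + 1 linear factors and the root polynomial without its i-th factor has n - 1. The
  -- surplus κ² is the one in `c3`.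
  have hpow : κ ^ (p.n + 1) = κ ^ s.card * κ ^ 2 := by
    rw [← pow_add]; congr 1; omega
  rw [hpow]
  have hG : G / P * P = G := div_mul_cancel₀ _ hP0
  generalize (∏ j ∈ s, p.h (u i) (u j)) = H at *
  generalize (∏ j ∈ s, p.f (u i) (u j)) = F at *
  generalize G / P = D at *
  rw [← hG]
  set μ := br p.q * u i ^ 2 / (br (u i ^ 2) * (p.q ^ 2 - (p.q ^ 2)⁻¹))
  linear_combination (κ ^ s.card * P * μ) * hE - κ ^ s.card * P * F * c1
    + κ ^ s.card * P * H * c2 - κ ^ s.card * P * D * c3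

lemma sum_xk (h : p.IsLeonardRep A B v vs) :
    ∑ k ∈ Finset.range (p.n + 1), p.xk k =
      -(p.z * (p.q * p.q ^ p.n - (p.q * p.q ^ p.n)⁻¹) /
        ((p.q - p.q⁻¹) * (p.q ^ 2 - (p.q ^ 2)⁻¹))) := by
  have hq := h.q_ne
  have hζ := h.ζ_ne
  have h6 := h.q_pow_sub_one_ne (k := 2) (by norm_num)
  have h7 := h.q_sq_add_one_ne
  have hk : p.q ^ 2 - (p.q ^ 2)⁻¹ = (p.q ^ 2 - 1) * (p.q ^ 2 + 1) / p.q ^ 2 := by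
    field_simp
    ring
  have h5 : p.q - p.q⁻¹ = (p.q ^ 2 - 1) / p.q := by field_simp
  have key : ∀ N : ℂ, N ≠ 0 → ∀ m : ℕ, ∑ k ∈ Finset.range m, p.xval (p.ζ ^ 2 / N * p.q ^ (2 * k)) =
      -((p.ζ ^ 2 / N * (p.q ^ (2 * m) - 1) / (p.q ^ 2 - 1) +
        N / p.ζ ^ 2 * p.q ^ 2 * (1 - (p.q ^ (2 * m))⁻¹) / (p.q ^ 2 - 1)) /
          (p.q ^ 2 - (p.q ^ 2)⁻¹)) := by
    intro N hN m
    induction m with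
    | zero => simp
    | succ m ih =>
      have e : p.q ^ (2 * (m + 1)) = p.q ^ 2 * p.q ^ (2 * m) := by ring
      have hQ : p.q ^ (2 * m) ≠ 0 := pow_ne_zero _ hq
      rw [Finset.sum_range_succ, ih, xval, e, hk]
      generalize p.q ^ (2 * m) = Q at *
      field_simp
      ring
  have hN : p.q ^ p.n ≠ 0 := pow_ne_zero _ hq
  have e : p.q ^ (2 * (p.n + 1)) = p.q ^ 2 * (p.q ^ p.n) ^ 2 := by ring
  simp only [xk]
  rw [key _ hN, z, hk, h5, e]
  generalize p.q ^ p.n = N at *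
  field_simp

lemma θofRoots_eq (h : p.IsLeonardRep A B v vs) (u : Fin p.n → ℂ) :
    p.θofRoots u = (p.q ^ (2 * p.n))⁻¹ * (p.a0 - p.q ^ 2 * (∑ i, p.rootPoint (u i)) * p.a1
      + p.a1 * ∑ k ∈ Finset.range (p.n + 1), p.xk k) := by
  have hq := h.q_ne
  have hζ := h.ζ_ne
  have hcs := h.cs_ne
  have h6 := h.q_pow_sub_one_ne (k := 2) (by norm_num)
  have h7 := h.q_sq_add_one_ne
  have hk : p.q ^ 2 - (p.q ^ 2)⁻¹ = (p.q ^ 2 - 1) * (p.q ^ 2 + 1) / p.q ^ 2 := by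
    field_simp
    ring
  have h5 : p.q - p.q⁻¹ = (p.q ^ 2 - 1) / p.q := by field_simp
  have hN : p.q ^ p.n ≠ 0 := pow_ne_zero _ hq
  have hsum : ∑ i, p.rootPoint (u i) =
      -((∑ j, (p.q * u j ^ 2 + p.q⁻¹ * (u j ^ 2)⁻¹)) / (p.q ^ 2 - (p.q ^ 2)⁻¹)) := by
    rw [Finset.sum_div, ← Finset.sum_neg_distrib]
    refine Finset.sum_congr rfl fun j _ => ?_
    rw [rootPoint, xval, mul_inv]
  rw [hsum, h.sum_xk, θofRoots, qNum, a0, a1, t, hk, h5, z]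
  generalize ∑ j, (p.q * u j ^ 2 + p.q⁻¹ * (u j ^ 2)⁻¹) = S
  congr 1
  generalize p.q ^ p.n = N at *
  field_simp
  ring

/-- The inhomogeneous `TQ`-relation. -/
lemma polyA_rootPoly (h : p.IsLeonardRep A B v vs) {u : Fin p.n → ℂ}
    (hu : p.IsBetheSolution 1 u) :
    p.polyA (p.rootPoly Finset.univ u) = C (p.θofRoots u) * p.rootPoly Finset.univ u
      + C ((p.q ^ (2 * p.n))⁻¹ * p.a1) * p.charFactor (p.n + 1) := by
  obtain ⟨t1, t2, t3, -⟩ := p.coeff_polyA_prod h.q_ne Finset.univ (fun i => p.rootPoint (u i))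
  change ∀ j, _ → (p.polyA (p.rootPoly Finset.univ u)).coeff j = 0 at t1
  change (p.polyA (p.rootPoly Finset.univ u)).coeff _ = _ at t2
  change (p.polyA (p.rootPoly Finset.univ u)).coeff _ = _ at t3
  rw [Finset.card_univ, Fintype.card_fin] at t1 t2 t3
  have hfdeg : (p.rootPoly Finset.univ u).natDegree = p.n := by
    rw [rootPoly, natDegree_finsetProd_X_sub_C_eq_card, Finset.card_univ, Fintype.card_fin]
  have hfmon : (p.rootPoly Finset.univ u).Monic := monic_prod_X_sub_C _ _
  have hFdeg : (p.charFactor (p.n + 1)).natDegree = p.n + 1 := by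
    rw [charFactor, natDegree_finsetProd_X_sub_C_eq_card, Finset.card_range]
  have hFmon : (p.charFactor (p.n + 1)).Monic := monic_prod_X_sub_C _ _
  have hF1 : (p.charFactor (p.n + 1)).coeff p.n = -∑ k ∈ Finset.range (p.n + 1), p.xk k := by
    have := prod_X_sub_C_coeff_card_pred (Finset.range (p.n + 1)) p.xk (by simp)
    rwa [Finset.card_range, Nat.add_sub_cancel] at this
  rw [← sub_eq_zero]
  set R := p.polyA (p.rootPoly Finset.univ u) - (C (p.θofRoots u) * p.rootPoly Finset.univ u
      + C ((p.q ^ (2 * p.n))⁻¹ * p.a1) * p.charFactor (p.n + 1)) with hR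
  -- In degree n + 1 the multiple of F cancels the leading term; in degree n the cancellation is the
  -- formula for θ(ū). What is left has degree below n and n distinct roots.
  have hcoeff : ∀ j, p.n ≤ j → R.coeff j = 0 := by
    intro j hj
    rw [hR, coeff_sub, coeff_add, coeff_C_mul, coeff_C_mul]
    rcases Nat.lt_or_ge (p.n + 1) j with h1 | h1
    · rw [t1 j h1, coeff_eq_zero_of_natDegree_lt (by omega),
        coeff_eq_zero_of_natDegree_lt (by omega)]
      ring
    · rcases (show j = p.n ∨ j = p.n + 1 by omega) with rfl | rfl
      · have h2 : (p.rootPoly Finset.univ u).coeff p.n = 1 := by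
          simpa only [Monic, leadingCoeff, hfdeg] using hfmon
        rw [t3, h2, hF1, h.θofRoots_eq]
        ring
      · have h2 : (p.charFactor (p.n + 1)).coeff (p.n + 1) = 1 := by
          simpa only [Monic, leadingCoeff, hFdeg] using hFmon
        rw [t2, h2, coeff_eq_zero_of_natDegree_lt (by omega)]
        ring
  by_contra hne
  have hdeg : R.natDegree < p.n := by
    by_contra! hle
    exact hne (leadingCoeff_eq_zero.1 (hcoeff _ hle))
  refine hne (eq_zero_of_natDegree_lt_card_of_eval_eq_zero R (f := fun i => p.rootPoint (u i))
    (fun i j hij => ?_) (fun i => ?_) (by rwa [Fintype.card_fin]))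
  · by_contra hne'
    exact h.rootPoint_ne hu hne' hij
  · have h0 : (p.rootPoly Finset.univ u).eval (p.rootPoint (u i)) = 0 := by
      rw [rootPoly, eval_prod]
      exact Finset.prod_eq_zero (Finset.mem_univ i) (by simp)
    rw [hR, eval_sub, eval_add, eval_mul, eval_mul, eval_C, eval_C, h0,
      h.eval_polyA_rootPoly hu]
    ring

lemma A_bethe (h : p.IsLeonardRep A B v vs) {u : Fin p.n → ℂ} (hu : p.IsBetheSolution 1 u) :
    A (aeval (p.opX A B) (p.rootPoly Finset.univ u) (vs 0)) =
      p.θofRoots u • aeval (p.opX A B) (p.rootPoly Finset.univ u) (vs 0) := by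
  rw [(h.apply_aeval _).1, h.polyA_rootPoly hu, map_add, map_mul, map_mul, h.aeval_charFactor,
    mul_zero, add_zero, aeval_C, Module.End.mul_apply, Module.algebraMap_end_apply]

end IsLeonardRep

end Params

/-! ### Last coordinates and the normalization of eigenvectors. -/

namespace Params

open Polynomial

/-- `X` raises the filtration of `V` by the eigenbasis of `A*` with this coefficient. -/
def raiseCoeff (p : Params) {V : Type*} [AddCommGroup V] [Module ℂ V] (A : Module.End ℂ V)
    (vs : Basis (Fin (p.n + 1)) ℂ V) (k : Fin p.n) : ℂ :=
  -(p.q ^ (2 * (k : ℕ) + 1) / (p.cs * (p.q ^ 2 - (p.q ^ 2)⁻¹))) *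
    vs.repr (A (vs k.castSucc)) k.succ

namespace IsLeonardRep

variable {V : Type*} [AddCommGroup V] [Module ℂ V]
variable {p : Params} {A B : Module.End ℂ V} {v vs : Basis (Fin (p.n + 1)) ℂ V}

/-- In qθ*_{k+1} - q⁻¹θ*_k the c* terms cancel, which leaves a single power of q. -/
lemma repr_X_subdiag (h : p.IsLeonardRep A B v vs) (k : Fin p.n) :
    vs.repr (p.opX A B (vs k.castSucc)) k.succ = p.raiseCoeff A vs k := by
  have hq := h.q_ne
  have hbs := h.bs_ne
  have hcs := h.cs_ne
  have h6 := h.q_pow_sub_one_ne (k := 2) (by norm_num)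
  have h7 := h.q_sq_add_one_ne
  have hk : p.q ^ 2 - (p.q ^ 2)⁻¹ = (p.q ^ 2 - 1) * (p.q ^ 2 + 1) / p.q ^ 2 := by
    field_simp
    ring
  have e1 : p.q ^ (2 * ((k : ℕ) + 1)) = p.q ^ 2 * p.q ^ (2 * (k : ℕ)) := by ring
  have e2 : p.q ^ (2 * (k : ℕ) + 1) = p.q * p.q ^ (2 * (k : ℕ)) := by ring
  have hQ : p.q ^ (2 * (k : ℕ)) ≠ 0 := pow_ne_zero _ hq
  rw [h.repr_X, Basis.repr_self, Finsupp.single_eq_of_ne (Fin.castSucc_lt_succ).ne', mul_zero,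
    add_zero, raiseCoeff]
  simp only [θs, Fin.val_succ, Fin.val_castSucc, ρ, h.bc_eq, e1, e2, hk]
  generalize p.q ^ (2 * (k : ℕ)) = Q at *
  field_simp
  ring

lemma raiseCoeff_ne_zero (h : p.IsLeonardRep A B v vs) (k : Fin p.n) :
    p.raiseCoeff A vs k ≠ 0 :=
  mul_ne_zero (neg_ne_zero.2 (div_ne_zero (pow_ne_zero _ h.q_ne)
    (mul_ne_zero h.cs_ne h.q_sq_sub_inv_ne))) (h.subdiag_ne_zero k)

/-- Each factor X - a raises the top index by one with coefficient `raiseCoeff`, and the shift by a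
cannot reach the new top coordinate; so the roots do not enter. -/
lemma repr_aeval_prod (h : p.IsLeonardRep A B v vs) {ι : Type*} (s : Finset ι) (a : ι → ℂ)
    (m : ℕ) (hm : m ≤ p.n) (hs : s.card = m) :
    (∀ i : Fin (p.n + 1), m < i →
      vs.repr (aeval (p.opX A B) (∏ j ∈ s, (X - C (a j))) (vs 0)) i = 0) ∧
    vs.repr (aeval (p.opX A B) (∏ j ∈ s, (X - C (a j))) (vs 0)) ⟨m, by omega⟩ =
      ∏ k : Fin m, p.raiseCoeff A vs (Fin.castLE hm k) := by
  classical
  induction m generalizing s with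
  | zero =>
    rw [Finset.card_eq_zero] at hs
    subst hs
    simp only [Finset.prod_empty, map_one, Module.End.one_apply, Basis.repr_self]
    refine ⟨fun i hi => Finsupp.single_eq_of_ne ?_, ?_⟩
    · rintro rfl
      simp at hi
    · rw [show (⟨0, by omega⟩ : Fin (p.n + 1)) = 0 from rfl]
      simp
  | succ m ih =>
    obtain ⟨j, t, hj, rfl, ht⟩ := Finset.card_eq_succ.1 hs
    obtain ⟨h1, h2⟩ := ih t (by omega) ht
    rw [Finset.prod_insert hj, map_mul, Module.End.mul_apply, map_sub, aeval_X, aeval_C,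
      LinearMap.sub_apply, Module.algebraMap_end_apply]
    set g := aeval (p.opX A B) (∏ j ∈ t, (X - C (a j))) (vs 0)
    have hzero : ∀ i j : Fin (p.n + 1), (j : ℕ) + 2 ≤ i →
        vs.repr (p.opX A B (vs j)) i = 0 := by
      intro i j hij
      rw [h.repr_X, h.entry_eq_zero hij, Basis.repr_self, Finsupp.single_eq_of_ne, mul_zero,
        mul_zero, add_zero, mul_zero]
      rintro rfl
      omega
    refine ⟨fun i hi => ?_, ?_⟩
    · rw [map_sub, map_smul, Finsupp.sub_apply, Finsupp.smul_apply, h1 i (by omega), smul_zero,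
        sub_zero, repr_apply_eq_sum]
      refine Finset.sum_eq_zero fun j _ => ?_
      by_cases hjm : m < (j : ℕ)
      · rw [h1 j hjm, zero_mul]
      · rw [hzero i j (by omega), mul_zero]
    · rw [map_sub, map_smul, Finsupp.sub_apply, Finsupp.smul_apply, h1 _ (by simp), smul_zero,
        sub_zero, repr_apply_eq_sum, Finset.sum_eq_single (⟨m, by omega⟩ : Fin (p.n + 1)), h2,
        Fin.prod_univ_castSucc]
      · congr 1
        exact h.repr_X_subdiag ⟨m, by omega⟩
      · intro j _ hjm
        rcases Nat.lt_or_ge m j with h3 | h3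
        · rw [h1 j h3, zero_mul]
        · have : (j : ℕ) ≠ m := fun h0 => hjm (Fin.ext h0)
          rw [hzero _ _ (by simp; omega), mul_zero]
      · simp

lemma repr_last_rootPoly (h : p.IsLeonardRep A B v vs) (u : Fin p.n → ℂ) :
    vs.repr (aeval (p.opX A B) (p.rootPoly Finset.univ u) (vs 0)) (Fin.last p.n) =
      ∏ k, p.raiseCoeff A vs k :=
  (h.repr_aeval_prod Finset.univ (fun i => p.rootPoint (u i)) p.n le_rfl (by simp)).2

lemma aeval_rootPoly_ne_zero (h : p.IsLeonardRep A B v vs) (u : Fin p.n → ℂ) :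
    aeval (p.opX A B) (p.rootPoly Finset.univ u) (vs 0) ≠ 0 := by
  intro h0
  have h1 := h.repr_last_rootPoly u
  rw [h0, map_zero, Finsupp.zero_apply] at h1
  exact Finset.prod_ne_zero_iff.2 (fun k _ => h.raiseCoeff_ne_zero k) h1.symm

lemma repr_A_eig (h : p.IsLeonardRep A B v vs) (x : V) (i : Fin (p.n + 1)) :
    v.repr (A x) i = p.θ i * v.repr x i := by
  have := h.swap.repr_B x i
  rwa [swap_θs] at this

lemma exists_θ_eq (h : p.IsLeonardRep A B v vs) {u : Fin p.n → ℂ} (hu : p.IsBetheSolution 1 u) :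
    ∃ M : Fin (p.n + 1), p.θ M = p.θofRoots u := by
  obtain ⟨M, hM⟩ : ∃ M, v.repr (aeval (p.opX A B) (p.rootPoly Finset.univ u) (vs 0)) M ≠ 0 := by
    by_contra! hall
    exact h.aeval_rootPoly_ne_zero u (v.ext_elem fun i => by simp [hall i])
  refine ⟨M, mul_right_cancel₀ hM ?_⟩
  rw [← h.repr_A_eig, h.A_bethe hu, map_smul, Finsupp.smul_apply, smul_eq_mul]

/-- The eigenvectors of `A`, normalized through their last coordinate. -/
lemma eigenvector_eq (h : p.IsLeonardRep A B v vs) {u : Fin p.n → ℂ}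
    (hu : p.IsBetheSolution 1 u) {M : Fin (p.n + 1)} (hM : p.θ M = p.θofRoots u) :
    v M = ((∏ k, p.raiseCoeff A vs k)⁻¹ * vs.repr (v M) (Fin.last p.n)) •
      aeval (p.opX A B) (p.rootPoly Finset.univ u) (vs 0) := by
  have h1 := h.repr_last_rootPoly u
  have h2 := h.A_bethe hu
  have h3 : ∏ k, p.raiseCoeff A vs k ≠ 0 :=
    Finset.prod_ne_zero_iff.2 fun k _ => h.raiseCoeff_ne_zero k
  set g := aeval (p.opX A B) (p.rootPoly Finset.univ u) (vs 0)
  -- Simplicity of the spectrum makes g proportional to the eigenvector; the factor is then read off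
  -- from the known last coordinate.
  have h4 : g = v.repr g M • v M := by
    refine v.ext_elem fun i => ?_
    rw [map_smul, Finsupp.smul_apply, smul_eq_mul, Basis.repr_self]
    by_cases hi : i = M
    · subst hi; simp
    · rw [Finsupp.single_eq_of_ne hi, mul_zero]
      have h5 := h.repr_A_eig g i
      rw [h2, map_smul, Finsupp.smul_apply, smul_eq_mul, ← hM] at h5
      by_contra h6
      exact hi (h.θ_inj _ _ (mul_right_cancel₀ h6 h5)).symm
  rw [h4, map_smul, Finsupp.smul_apply, smul_eq_mul] at h1
  have h7 := left_ne_zero_of_mul (h1 ▸ h3)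
  have h8 := right_ne_zero_of_mul (h1 ▸ h3)
  rw [h4, smul_smul, ← h1]
  have h9 : ((v.repr g M * vs.repr (v M) (Fin.last p.n))⁻¹ * vs.repr (v M) (Fin.last p.n)) *
      v.repr g M = 1 := by field_simp
  conv_lhs => rw [← one_smul ℂ (v M), ← h9]

end IsLeonardRep

end Params

namespace Params

open Polynomial

/-! Exchanging `A` and `A*`: the equations `E₋` at `w̄` become the equations `E₊` at `w̄⁻¹`. -/

section Swap

variable (p : Params)

lemma swap_f (x y : ℂ) : p.swap.f x⁻¹ y⁻¹ = p.f x y := by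
  have e1 : p.q⁻¹ * y⁻¹ / x⁻¹ = (p.q * y / x)⁻¹ := by ring
  have e2 : x⁻¹ * y⁻¹ = (x * y)⁻¹ := (mul_inv x y).symm
  have e3 : y⁻¹ / x⁻¹ = (y / x)⁻¹ := by ring
  have e4 : p.q⁻¹ * x⁻¹ * y⁻¹ = (p.q * x * y)⁻¹ := by ring
  rw [f, swap_q, e1, e2, e3, e4, br_inv, br_inv, br_inv, br_inv, f]
  simp only [neg_mul, mul_neg, neg_neg]

lemma swap_h (x y : ℂ) : p.swap.h x⁻¹ y⁻¹ = p.h x y := by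
  have e1 : p.q⁻¹ ^ 2 * x⁻¹ * y⁻¹ = (p.q ^ 2 * x * y)⁻¹ := by ring
  have e2 : p.q⁻¹ * x⁻¹ / y⁻¹ = (p.q * x / y)⁻¹ := by ring
  have e3 : x⁻¹ / y⁻¹ = (x / y)⁻¹ := by ring
  have e4 : p.q⁻¹ * x⁻¹ * y⁻¹ = (p.q * x * y)⁻¹ := by ring
  rw [h, swap_q, e1, e2, e3, e4, br_inv, br_inv, br_inv, br_inv, h]
  simp only [neg_mul, mul_neg, neg_neg]

lemma br_swap_q (x : ℂ) : br (p.swap.q * x⁻¹ ^ 2) = -br (p.q * x ^ 2) := by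
  rw [swap_q, inv_pow, ← mul_inv, br_inv]

lemma swap_Λ1 (hq : p.q ≠ 0) (hζ : p.ζ ≠ 0) {x : ℂ} (hx : x ≠ 0) :
    p.swap.Λ1 1 x⁻¹ = p.Λ1 (-1) x := by
  have hN : p.q ^ p.n ≠ 0 := pow_ne_zero _ hq
  have z0 : ((1 : ℤ) - 1) / 2 = 0 := by norm_num
  have z1 : ((1 : ℤ) + 1) / 2 = 1 := by norm_num
  have z2 : ((1 : ℤ) - -1) / 2 = 1 := by norm_num
  have z3 : ((1 : ℤ) + -1) / 2 = 0 := by norm_num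
  rw [Λ1, Λ1, swap_q, z0, z1, z2, z3]
  change (p.q⁻¹ ^ (p.n + 1))⁻¹ / x⁻¹ ^ (1 : ℤ)
    * (p.q⁻¹ ^ (p.n + 1) * x⁻¹ * p.ζ⁻¹ - x⁻¹⁻¹ * p.ζ)
    * (p.q⁻¹ ^ (p.n + 1) * x⁻¹ * p.ζ - x⁻¹⁻¹ * p.ζ⁻¹)
    * (x⁻¹ * p.b * (p.q⁻¹ ^ p.n)⁻¹ + x⁻¹⁻¹ * p.cs * p.q⁻¹ ^ p.n)
    * (x⁻¹ * (p.bs / p.b) ^ (0 : ℤ) + x⁻¹⁻¹ * (p.c / p.cs) ^ (1 : ℤ)) = _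
  simp only [zpow_zero, zpow_one, zpow_neg, inv_pow, inv_inv, N_pow]
  generalize p.q ^ p.n = N at *
  generalize p.c / p.cs = k at *
  field_simp
  ring

lemma swap_Λ2 (hq : p.q ≠ 0) (hζ : p.ζ ≠ 0) {x : ℂ} (hx : x ≠ 0) :
    (p.swap.q ^ 2 * x⁻¹ ^ 3) ^ (-(1 : ℤ)) * p.swap.Λ2 1 x⁻¹ =
      (p.q ^ 2 * x ^ 3) ^ (-(-1 : ℤ)) * p.Λ2 (-1) x := by
  have hN : p.q ^ p.n ≠ 0 := pow_ne_zero _ hq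
  have z0 : ((1 : ℤ) - 1) / 2 = 0 := by norm_num
  have z1 : ((1 : ℤ) + 1) / 2 = 1 := by norm_num
  have z2 : ((1 : ℤ) - -1) / 2 = 1 := by norm_num
  have z3 : ((1 : ℤ) + -1) / 2 = 0 := by norm_num
  have hNz : p.q ^ ((p.n : ℤ) - 1) = p.q ^ p.n / p.q := by
    rw [zpow_sub₀ hq, zpow_natCast, zpow_one]
  have hNz' : p.q⁻¹ ^ ((p.n : ℤ) - 1) = (p.q ^ p.n / p.q)⁻¹ := by rw [inv_zpow, hNz]
  rw [Λ2, Λ2, br_swap_q, swap_q, z0, z1, z2, z3]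
  change (p.q⁻¹ ^ 2 * x⁻¹ ^ 3) ^ (-(1 : ℤ)) *
    (br (x⁻¹ ^ 2) * (p.q⁻¹ ^ (p.n + 1))⁻¹ / (x⁻¹ ^ (1 : ℤ) * -br (p.q * x ^ 2))
    * (p.q⁻¹ ^ ((p.n : ℤ) - 1) * x⁻¹⁻¹ * p.ζ - x⁻¹ * p.ζ⁻¹)
    * (p.q⁻¹ ^ ((p.n : ℤ) - 1) * x⁻¹⁻¹ * p.ζ⁻¹ - x⁻¹ * p.ζ)
    * (p.q⁻¹ ^ 2 * x⁻¹ * p.cs * p.q⁻¹ ^ p.n + x⁻¹⁻¹ * p.b * (p.q⁻¹ ^ p.n)⁻¹)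
    * (p.q⁻¹ ^ 2 * x⁻¹ * (p.c / p.cs) ^ (1 : ℤ) + x⁻¹⁻¹ * (p.bs / p.b) ^ (0 : ℤ))) = _
  rw [inv_pow x 2, br_inv, mul_neg, hNz, hNz']
  simp only [zpow_zero, zpow_one, zpow_neg, inv_pow, inv_inv, N_pow]
  generalize p.q ^ p.n = N at *
  generalize p.c / p.cs = k at *
  -- Regularity is not assumed here; if this denominator vanishes, both sides are zero by the
  -- convention for division.
  by_cases hB : br (p.q * x ^ 2) = 0
  · simp [hB]
  generalize br (p.q * x ^ 2) = B at *
  generalize br (x ^ 2) = D at *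
  field_simp
  ring

/-- Inverting q and all roots inverts every argument of b, up to exchanging ζ and ζ⁻¹ in the last
product. As b is odd, the signs cancel in pairs. -/
lemma swap_E (hq : p.q ≠ 0) (hζ : p.ζ ≠ 0) {w : Fin p.n → ℂ} (hw : ∀ i, w i ≠ 0)
    (i : Fin p.n) : p.swap.E 1 (fun i => (w i)⁻¹) i = p.E (-1) w i := by
  have h1 : br ((w i)⁻¹ ^ 2) / br (p.swap.q * (w i)⁻¹ ^ 2) = br (w i ^ 2) / br (p.q * w i ^ 2) := by
    rw [br_swap_q, inv_pow, br_inv, neg_div_neg_eq]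
  have h2 : ∏ j ∈ Finset.univ.erase i, p.swap.f (w i)⁻¹ (w j)⁻¹ =
      ∏ j ∈ Finset.univ.erase i, p.f (w i) (w j) :=
    Finset.prod_congr rfl fun j _ => p.swap_f _ _
  have h3 : ∏ j ∈ Finset.univ.erase i, p.swap.h (w i)⁻¹ (w j)⁻¹ =
      ∏ j ∈ Finset.univ.erase i, p.h (w i) (w j) :=
    Finset.prod_congr rfl fun j _ => p.swap_h _ _
  have h4 : ∏ j ∈ Finset.univ.erase i,
        (br ((w i)⁻¹ * (w j)⁻¹⁻¹) * br (p.swap.q * (w i)⁻¹ * (w j)⁻¹)) =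
      ∏ j ∈ Finset.univ.erase i, (br (w i * (w j)⁻¹) * br (p.q * w i * w j)) := by
    refine Finset.prod_congr rfl fun j _ => ?_
    rw [swap_q, ← mul_inv, ← mul_inv, ← mul_inv, br_inv, br_inv, neg_mul_neg]
  have h5 : ∏ k ∈ Finset.range (p.n + 1),
        (br (p.r⁻¹ ^ (1 + 2 * (k : ℤ) - p.n) * p.ζ * (w i)⁻¹)
          * br (p.r⁻¹ ^ (1 + 2 * (k : ℤ) - p.n) * p.ζ⁻¹ * (w i)⁻¹)) =
      ∏ k ∈ Finset.range (p.n + 1),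
        (br (p.r ^ (1 + 2 * (k : ℤ) - p.n) * p.ζ * w i)
          * br (p.r ^ (1 + 2 * (k : ℤ) - p.n) * p.ζ⁻¹ * w i)) := by
    refine Finset.prod_congr rfl fun k _ => ?_
    have e : ∀ R y x : ℂ, R⁻¹ * y * x⁻¹ = (R * y⁻¹ * x)⁻¹ := fun R y x => by rw [mul_inv, mul_inv, inv_inv]
    rw [inv_zpow, e, e, br_inv, br_inv, inv_inv, neg_mul_neg, mul_comm]
  have h6 : p.swap.ν 1 = p.ν (-1) := by
    rw [ν, ν, if_pos rfl, if_neg (by norm_num), swap_q, inv_pow, inv_inv]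
    rfl
  have h7 : (w i)⁻¹ ^ (-2 * (1 : ℤ)) * br ((w i)⁻¹ ^ 2) / br p.swap.q =
      w i ^ (-2 * (-1 : ℤ)) * br (w i ^ 2) / br p.q := by
    rw [swap_q, inv_pow, br_inv, br_inv, mul_neg, neg_div_neg_eq, inv_zpow', mul_neg]
  have h8 := p.swap_Λ1 hq hζ (hw i)
  have h9 := p.swap_Λ2 hq hζ (hw i)
  have h10 : (w i)⁻¹ ^ (1 : ℤ) = w i ^ (-1 : ℤ) := by simp
  change br ((w i)⁻¹ ^ 2) / br (p.swap.q * (w i)⁻¹ ^ 2) * (w i)⁻¹ ^ (1 : ℤ)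
      * (∏ j ∈ Finset.univ.erase i, p.swap.f (w i)⁻¹ (w j)⁻¹) * p.swap.Λ1 1 (w i)⁻¹
    - (p.swap.q ^ 2 * (w i)⁻¹ ^ 3) ^ (-(1 : ℤ))
      * (∏ j ∈ Finset.univ.erase i, p.swap.h (w i)⁻¹ (w j)⁻¹) * p.swap.Λ2 1 (w i)⁻¹
    + p.swap.ν 1 * ((w i)⁻¹ ^ (-2 * (1 : ℤ)) * br ((w i)⁻¹ ^ 2) / br p.swap.q)
      * ((∏ k ∈ Finset.range (p.n + 1),
            (br (p.r⁻¹ ^ (1 + 2 * (k : ℤ) - p.n) * p.ζ * (w i)⁻¹)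
              * br (p.r⁻¹ ^ (1 + 2 * (k : ℤ) - p.n) * p.ζ⁻¹ * (w i)⁻¹)))
          / ∏ j ∈ Finset.univ.erase i,
            (br ((w i)⁻¹ * (w j)⁻¹⁻¹) * br (p.swap.q * (w i)⁻¹ * (w j)⁻¹))) = _
  rw [E, h1, h2, h3, h4, h5, h6, h7, h8, h10, mul_right_comm _ (∏ j ∈ _, p.h _ _), h9,
    mul_right_comm _ (p.Λ2 _ _)]

lemma swap_isBetheSolution (hq : p.q ≠ 0) (hζ : p.ζ ≠ 0) {w : Fin p.n → ℂ}
    (hw : p.IsBetheSolution (-1) w) : p.swap.IsBetheSolution 1 (fun i => (w i)⁻¹) where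
  ne_zero := fun i => inv_ne_zero (hw.ne_zero i)
  nontrivial := fun i h0 => hw.nontrivial i (by
    rw [inv_pow, inv_inv] at h0
    exact h0.symm)
  regular := fun i => by
    rw [br_swap_q]
    exact neg_ne_zero.2 (hw.regular i)
  admissible := fun i j hij => by
    have e : ∀ x : ℂ, p.swap.U x⁻¹ = p.U x := fun x => by
      rw [U, U, swap_q, inv_pow, inv_inv, ← mul_inv, inv_inv, add_comm, add_comm p.q]
    rw [e, e]
    exact hw.admissible i j hij
  bethe := fun i => (p.swap_E hq hζ hw.ne_zero i).trans (hw.bethe i)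

lemma swap_θofRoots (w : Fin p.n → ℂ) :
    p.swap.θofRoots (fun i => (w i)⁻¹) = p.θsOfRoots w := by
  have h1 : qNum p.q⁻¹ p.n = qNum p.q p.n := by
    rw [qNum, qNum, inv_pow, inv_inv, inv_inv, ← neg_sub (p.q ^ p.n), ← neg_sub p.q,
      neg_div_neg_eq]
  have h2 : ∑ j, (p.q⁻¹ * (w j)⁻¹ ^ 2 + p.q⁻¹⁻¹ * ((w j)⁻¹ ^ 2)⁻¹) =
      ∑ j, (p.q * w j ^ 2 + p.q⁻¹ * (w j ^ 2)⁻¹) :=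
    Finset.sum_congr rfl fun j _ => by rw [inv_inv, inv_pow, inv_inv, add_comm]
  rw [θofRoots, swap_q]
  change (p.q⁻¹ ^ (2 * p.n))⁻¹ * (p.b * (p.ζ ^ 2 + (p.ζ ^ 2)⁻¹) * qNum p.q⁻¹ p.n
    + p.q⁻¹ ^ p.n * (p.cs * p.q⁻¹ ^ p.n + p.bs * (p.q⁻¹ ^ p.n)⁻¹)
    - p.q⁻¹ * p.b * ∑ j, (p.q⁻¹ * (w j)⁻¹ ^ 2 + p.q⁻¹⁻¹ * ((w j)⁻¹ ^ 2)⁻¹)) = _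
  rw [h1, h2, θsOfRoots, inv_pow, inv_inv, inv_pow, inv_inv]
  ring

lemma swap_rootPoint (x : ℂ) : p.swap.rootPoint x⁻¹ = -p.rootPoint x := by
  rw [rootPoint, rootPoint, xval, xval, swap_q, inv_pow, inv_pow, ← mul_inv, inv_inv, inv_inv,
    ← neg_sub (p.q ^ 2), div_neg, add_comm]

lemma aeval_swap_rootPoly {V : Type*} [AddCommGroup V] [Module ℂ V] (X' : Module.End ℂ V)
    (w : Fin p.n → ℂ) :
    aeval (-X') (p.swap.rootPoly Finset.univ (fun i => (w i)⁻¹)) =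
      (-1 : ℂ) ^ p.n • aeval X' (p.rootPoly Finset.univ w) := by
  have h1 : aeval (-X') (p.swap.rootPoly Finset.univ (fun i => (w i)⁻¹)) =
      aeval X' ((p.swap.rootPoly Finset.univ (fun i => (w i)⁻¹)).comp (-X)) := by
    rw [aeval_comp, map_neg, aeval_X]
  have h2 : (p.swap.rootPoly Finset.univ (fun i => (w i)⁻¹)).comp (-X) =
      C ((-1 : ℂ) ^ p.n) * p.rootPoly Finset.univ w := by
    rw [rootPoly, prod_comp, rootPoly]
    have : ∀ i : Fin p.n, (X - C (p.swap.rootPoint (w i)⁻¹)).comp (-X) =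
        C (-1) * (X - C (p.rootPoint (w i))) := fun i => by
      rw [swap_rootPoint]
      simp
      ring
    simp only [this, Finset.prod_mul_distrib]
    simp
  rw [h1, h2, ← smul_eq_C_mul, map_smul]

end Swap

end Params

/-! ### Bethe states as polynomials in X applied to a lowest vector. -/

namespace Params

open Polynomial

section Rep

variable {V : Type*} [AddCommGroup V] [Module ℂ V] {p : Params}
  (π : p.Alg →ₐ[ℂ] Module.End ℂ V)

lemma map_qComm {R S : Type*} [Ring R] [Algebra ℂ R] [Ring S] [Algebra ℂ S] (φ : R →ₐ[ℂ] S)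
    (q : ℂ) (x y : R) : φ (qComm q x y) = qComm q (φ x) (φ y) := by
  simp only [qComm, map_sub, map_smul, map_mul]

lemma rep_aw1 : qComm p.q⁻¹ (π p.A) (qComm p.q (π p.A) (π p.As)) =
    p.ρ • π p.As + p.ω • π p.A + p.η • 1 := by
  have h := congrArg π (RingQuot.mkAlgHom_rel ℂ
    (AWRel.aw1 (q := p.q) (ρ := p.ρ) (ω := p.ω) (η := p.η) (ηs := p.ηs)))
  simp only [map_qComm, map_add, map_smul, map_one] at h
  exact h

lemma rep_aw2 : qComm p.q⁻¹ (π p.As) (qComm p.q (π p.As) (π p.A)) =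
    p.ρ • π p.A + p.ω • π p.As + p.ηs • 1 := by
  have h := congrArg π (RingQuot.mkAlgHom_rel ℂ
    (AWRel.aw2 (q := p.q) (ρ := p.ρ) (ω := p.ω) (η := p.η) (ηs := p.ηs)))
  simp only [map_qComm, map_add, map_smul, map_one] at h
  exact h

/-- Passes from irreducibility under the whole algebra to irreducibility under its two generators.
-/
lemma rep_mem (W : Submodule ℂ V) (hA : ∀ w ∈ W, π p.A w ∈ W) (hB : ∀ w ∈ W, π p.As w ∈ W)
    (x : p.Alg) : ∀ w ∈ W, π x w ∈ W := by
  obtain ⟨y, rfl⟩ := RingQuot.mkAlgHom_surjective ℂ (AWRel p.q p.ρ p.ω p.η p.ηs) x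
  induction y using FreeAlgebra.induction with
  | grade0 a =>
    intro w hw
    rw [AlgHom.commutes, AlgHom.commutes, Module.algebraMap_end_apply]
    exact W.smul_mem a hw
  | grade1 g =>
    cases g with
    | A => exact hA
    | Astar => exact hB
  | mul a b ha hb =>
    intro w hw
    rw [map_mul, map_mul, Module.End.mul_apply]
    exact ha _ (hb _ hw)
  | add a b ha hb =>
    intro w hw
    rw [map_add, map_add, LinearMap.add_apply]
    exact W.add_mem (ha _ hw) (hb _ hw)

lemma map_K12 (u : ℂ) :
    π (p.K12 u) = (p.χ * br (u ^ 2)) •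
      (p.opX (π p.A) (π p.As) - algebraMap ℂ _ (p.rootPoint u)) := by
  rw [K12, map_smul, map_add, map_smul, map_add, map_smul, map_smul, map_one, map_qComm,
    Algebra.algebraMap_eq_smul_one, opX, rootPoint, xval, neg_smul, sub_neg_eq_add]

/-- With β = 0 the gauge vector is (0, 1)ᵗ, so only K₁₂ remains, and γ reduces to its α term. -/
lemma map_dynB_plus (α u : ℂ) (m : ℤ) :
    π (p.dynB 1 α 0 u m) = ((p.q * u)⁻¹ / (α * p.q ^ (m + 1)) * (p.χ * br (u ^ 2))) •
      (p.opX (π p.A) (π p.As) - algebraMap ℂ _ (p.rootPoint u)) := by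
  have z0 : ((1 : ℤ) - 1) / 2 = 0 := by norm_num
  have z1 : ((1 : ℤ) + 1) / 2 = 1 := by norm_num
  rw [dynB, γ, gauge, gauge, z0, z1]
  simp only [zero_mul, zero_smul, zpow_zero, zpow_one, zpow_neg, mul_zero, zero_add, sub_zero,
    map_smul, map_K12, smul_smul, inv_one, mul_one, zero_sub, Int.cast_one]
  congr 1
  rw [neg_one_mul, neg_div_neg_eq]

lemma map_dynB_minus (α u : ℂ) (m : ℤ) :
    π (p.dynB (-1) α 0 u m) = (p.q * u / (α * p.q ^ (-(m + 1))) * (p.χ * br (u ^ 2))) •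
      (p.opX (π p.A) (π p.As) - algebraMap ℂ _ (p.rootPoint u)) := by
  have z2 : ((1 : ℤ) - -1) / 2 = 1 := by norm_num
  have z3 : ((1 : ℤ) + -1) / 2 = 0 := by norm_num
  rw [dynB, γ, gauge, gauge, z2, z3]
  simp only [zero_mul, zero_smul, zpow_zero, zpow_one, mul_zero, zero_add, sub_zero,
    map_smul, map_K12, smul_smul, inv_one, mul_one, neg_neg, Int.cast_neg, Int.cast_one, one_mul]

lemma betheState_eq {ε : ℤ} {α : ℂ} {m₀ : ℤ} (Ω : V) {u : Fin p.n → ℂ} (s : Fin p.n → ℂ)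
    (hs : ∀ i : Fin p.n, π (p.dynB ε α 0 (u i) (m₀ + 2 * ((p.n : ℤ) - 1 - (i : ℕ)))) = s i •
      (p.opX (π p.A) (π p.As) - algebraMap ℂ _ (p.rootPoint (u i)))) :
    p.betheState π ε α m₀ Ω u =
      (∏ i, s i) • aeval (p.opX (π p.A) (π p.As)) (p.rootPoly Finset.univ u) Ω := by
  have h1 : ∀ i : Fin p.n, π (p.dynB ε α 0 (u i) (m₀ + 2 * ((p.n : ℤ) - 1 - (i : ℕ)))) =
      aeval (p.opX (π p.A) (π p.As)) (C (s i) * (X - C (p.rootPoint (u i)))) := fun i => by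
    rw [hs, ← smul_eq_C_mul, map_smul, map_sub, aeval_X, aeval_C]
  rw [betheState, stringB, map_list_prod, List.map_ofFn, Function.comp_def]
  simp only [h1]
  rw [← Function.comp_def (aeval (p.opX (π p.A) (π p.As))), ← List.map_ofFn, ← map_list_prod,
    List.prod_ofFn, Finset.prod_mul_distrib, ← map_prod, ← smul_eq_C_mul, map_smul]
  rfl

/-- The dynamical shifts run down while the powers of q in `raiseCoeff` run up: they cancel in the
whole product, not factor by factor. -/
lemma prod_reflect_pow (q : ℂ) (hq : q ≠ 0) (n : ℕ) :
    ∏ k : Fin n, q ^ (2 * (k : ℕ) : ℤ) * q ^ (-(2 * ((n : ℤ) - 1 - (k : ℕ)))) = 1 := by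
  rw [Finset.prod_mul_distrib, ← Equiv.prod_comp Fin.revPerm
    (fun k : Fin n => q ^ (-(2 * ((n : ℤ) - 1 - (k : ℕ))))), ← Finset.prod_mul_distrib]
  refine Finset.prod_eq_one fun k _ => ?_
  rw [← zpow_add₀ hq, Fin.revPerm_apply, Fin.val_rev, Nat.cast_sub (by omega)]
  rw [show (2 * (k : ℕ) : ℤ) + -(2 * ((n : ℤ) - 1 - ((n : ℤ) - ((k : ℕ) + 1 : ℕ)))) = 0 by
    push_cast; ring, zpow_zero]

variable {π}
variable {v vs : Basis (Fin (p.n + 1)) ℂ V}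

lemma IsLeonardRep.br_ne_zero {ε : ℤ} {u : Fin p.n → ℂ} (hu : p.IsBetheSolution ε u)
    (i : Fin p.n) : br (u i ^ 2) ≠ 0 := sub_ne_zero.2 (hu.nontrivial i)

lemma IsLeonardRep.normStar_mul (h : p.IsLeonardRep (π p.A) (π p.As) v vs) (hχ : p.χ ≠ 0)
    {m₀ : ℤ} {α : ℂ} (hα : (p.q ^ 2 - (p.q ^ 2)⁻¹) * p.χ⁻¹ * α * p.cs * p.q ^ m₀ = 1)
    {u : Fin p.n → ℂ} (hu : p.IsBetheSolution 1 u) :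
    p.normStar π vs u * (∏ i : Fin p.n, ((p.q * u i)⁻¹ /
      (α * p.q ^ (m₀ + 2 * ((p.n : ℤ) - 1 - (i : ℕ)) + 1)) * (p.χ * br (u i ^ 2)))) =
      (∏ k, p.raiseCoeff (π p.A) vs k)⁻¹ := by
  have hq := h.q_ne
  have hcs := h.cs_ne
  have h4 := h.q_sq_sub_inv_ne
  have h3 : ∏ k, p.raiseCoeff (π p.A) vs k ≠ 0 :=
    Finset.prod_ne_zero_iff.2 fun k _ => h.raiseCoeff_ne_zero k
  -- The right-hand 1 is replaced by the reflected product of powers of q, after which the identity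
  -- holds for each k separately.
  rw [← mul_eq_one_iff_eq_inv₀ h3, normStar, ← Finset.prod_mul_distrib, ← Finset.prod_mul_distrib,
    ← prod_reflect_pow p.q hq p.n]
  refine Finset.prod_congr rfl fun k _ => ?_
  have ha := h.subdiag_ne_zero k
  have hb := IsLeonardRep.br_ne_zero hu k
  have hk := hu.ne_zero k
  have hm : p.q ^ m₀ ≠ 0 := zpow_ne_zero _ hq
  have hα' : α = p.χ / ((p.q ^ 2 - (p.q ^ 2)⁻¹) * p.cs * p.q ^ m₀) := by
    rw [eq_div_iff (mul_ne_zero (mul_ne_zero h4 hcs) hm)]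
    field_simp at hα ⊢
    linear_combination hα
  have e1 : p.q ^ (m₀ + 2 * ((p.n : ℤ) - 1 - (k : ℕ)) + 1) =
      p.q ^ m₀ * p.q ^ (2 * ((p.n : ℤ) - 1 - (k : ℕ))) * p.q := by
    rw [zpow_add_one₀ hq, zpow_add₀ hq]
  have e2 : p.q ^ (2 * (k : ℕ) : ℤ) = p.q ^ (2 * (k : ℕ)) := by norm_cast
  have e3 : p.q ^ (2 * (k : ℕ) + 1) = p.q ^ (2 * (k : ℕ)) * p.q := pow_succ _ _
  have hz : p.q ^ (2 * ((p.n : ℤ) - 1 - (k : ℕ))) ≠ 0 := zpow_ne_zero _ hq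
  rw [raiseCoeff, LinearMap.toMatrix_apply, hα', e1, e2, e3, zpow_neg]
  generalize p.q ^ (2 * ((p.n : ℤ) - 1 - (k : ℕ))) = Z at *
  generalize p.q ^ m₀ = Y at *
  generalize vs.repr ((π p.A) (vs k.castSucc)) k.succ = a at *
  generalize p.q ^ 2 - (p.q ^ 2)⁻¹ = κ at *
  generalize br (u k ^ 2) = D at *
  field_simp

lemma IsLeonardRep.norm_mul (h : p.IsLeonardRep (π p.A) (π p.As) v vs) (hχ : p.χ ≠ 0)
    {m₀ : ℤ} {α : ℂ} (hα : (p.q ^ 2 - (p.q ^ 2)⁻¹) * p.χ⁻¹ * α * p.b * p.q ^ (-m₀) = -1)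
    {u : Fin p.n → ℂ} (hu : p.IsBetheSolution (-1) u) :
    p.norm π v u * (∏ i : Fin p.n, (p.q * u i /
      (α * p.q ^ (-(m₀ + 2 * ((p.n : ℤ) - 1 - (i : ℕ)) + 1))) * (p.χ * br (u i ^ 2)))) =
      (-1) ^ p.n * (∏ k, p.swap.raiseCoeff (π p.As) v k)⁻¹ := by
  have hq := h.q_ne
  have hcs := h.b_ne
  have h4 := h.q_sq_sub_inv_ne
  have h3 : ∏ k, p.swap.raiseCoeff (π p.As) v k ≠ 0 :=
    Finset.prod_ne_zero_iff.2 fun k _ => h.swap.raiseCoeff_ne_zero k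
  -- The same device with q⁻¹, the parameter of the exchanged data. The sign reflects X → -X in each
  -- of the n factors.
  have h5 : (-1 : ℂ) ^ p.n = ∏ k : Fin p.n, (-1 : ℂ) *
      (p.q⁻¹ ^ (2 * (k : ℕ) : ℤ) * p.q⁻¹ ^ (-(2 * ((p.n : ℤ) - 1 - (k : ℕ))))) := by
    rw [Finset.prod_mul_distrib, prod_reflect_pow p.q⁻¹ (inv_ne_zero hq) p.n]
    simp
  rw [eq_mul_inv_iff_mul_eq₀ h3, h5, norm, ← Finset.prod_mul_distrib]
  refine (Finset.prod_mul_distrib (s := Finset.univ)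
    (g := fun k : Fin p.n => p.swap.raiseCoeff (π p.As) v k)).symm.trans ?_
  refine Finset.prod_congr rfl fun k _ => ?_
  have ha : v.repr ((π p.As) (v k.castSucc)) k.succ ≠ 0 := h.swap.subdiag_ne_zero k
  have hb := IsLeonardRep.br_ne_zero hu k
  have hk := hu.ne_zero k
  have hm : p.q ^ m₀ ≠ 0 := zpow_ne_zero _ hq
  have hα' : α = -(p.χ * p.q ^ m₀ / ((p.q ^ 2 - (p.q ^ 2)⁻¹) * p.b)) := by
    rw [← neg_div, eq_div_iff (mul_ne_zero h4 hcs)]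
    rw [zpow_neg] at hα
    field_simp at hα ⊢
    linear_combination hα
  have e1 : p.q ^ (-(m₀ + 2 * ((p.n : ℤ) - 1 - (k : ℕ)) + 1)) =
      (p.q ^ m₀ * p.q ^ (2 * ((p.n : ℤ) - 1 - (k : ℕ))) * p.q)⁻¹ := by
    rw [zpow_neg, zpow_add_one₀ hq, zpow_add₀ hq]
  have e2 : p.q⁻¹ ^ (2 * (k : ℕ) : ℤ) = (p.q ^ (2 * (k : ℕ)))⁻¹ := by
    rw [inv_zpow]; norm_cast
  have hz : p.q ^ (2 * ((p.n : ℤ) - 1 - (k : ℕ))) ≠ 0 := zpow_ne_zero _ hq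
  have hr : p.swap.raiseCoeff (π p.As) v k = (p.q ^ (2 * (k : ℕ)) * p.q)⁻¹ /
      (p.b * (p.q ^ 2 - (p.q ^ 2)⁻¹)) * v.repr ((π p.As) (v k.castSucc)) k.succ := by
    change -(p.swap.q ^ (2 * (k : ℕ) + 1) / (p.b * (p.swap.q ^ 2 - (p.swap.q ^ 2)⁻¹))) *
      v.repr ((π p.As) (v k.castSucc)) k.succ = _
    rw [swap_q, inv_pow, inv_pow, inv_inv, ← neg_sub (p.q ^ 2), mul_neg, div_neg, neg_neg,
      pow_succ]
  rw [hr, LinearMap.toMatrix_apply, hα', e1, e2, zpow_neg, inv_zpow, inv_inv]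
  generalize p.q ^ (2 * ((p.n : ℤ) - 1 - (k : ℕ))) = Z at *
  generalize p.q ^ m₀ = Y at *
  generalize v.repr ((π p.As) (v k.castSucc)) k.succ = a at *
  generalize p.q ^ 2 - (p.q ^ 2)⁻¹ = κ at *
  generalize br (u k ^ 2) = D at *
  field_simp

end Rep

end Params

end AWBethe

end

theorem mainTheorem5
    (p : AWBethe.Params)
    -- the scalars: `q` is nonzero and not a root of unity, the others are nonzero, and `b c = b* c*`
    (hr : p.r ≠ 0) (hq : ∀ k : ℕ, 0 < k → p.q ^ k ≠ 1) (hζ : p.ζ ≠ 0) (hχ : p.χ ≠ 0)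
    (hb : p.b ≠ 0) (hc : p.c ≠ 0) (hbs : p.bs ≠ 0) (hcs : p.cs ≠ 0)
    (hρ : p.b * p.c = p.bs * p.cs)
    -- the representation, of dimension `2s + 1`
    {V : Type*} [AddCommGroup V] [Module ℂ V]
    (π : p.Alg →ₐ[ℂ] Module.End ℂ V)
    -- it is irreducible
    (hirr : ∀ W : Submodule ℂ V, (∀ x : p.Alg, ∀ w ∈ W, π x w ∈ W) → W = ⊥ ∨ W = ⊤)
    -- the eigenbases `|θ_M⟩` of `π(A)` and `|θ*_N⟩` of `π(A*)`, with simple spectra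
    (v vs : Module.Basis (Fin (p.n + 1)) ℂ V)
    (hv : ∀ M, π p.A (v M) = p.θ M • v M)
    (hvs : ∀ N, π p.As (vs N) = p.θs N • vs N)
    (hθ : ∀ M M' : Fin (p.n + 1), p.θ M = p.θ M' → M = M')
    (hθs : ∀ N N' : Fin (p.n + 1), p.θs N = p.θs N' → N = N')
    -- the gauge parameters `α` of the two kinds of Bethe states
    (m₀ : ℤ) (αp αm : ℂ)
    (hαp : (p.q ^ 2 - (p.q ^ 2)⁻¹) * p.χ⁻¹ * αp * p.cs * p.q ^ m₀ = 1)
    (hαm : (p.q ^ 2 - (p.q ^ 2)⁻¹) * p.χ⁻¹ * αm * p.b * p.q ^ (-m₀) = -1) :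
    -- the normalized Bethe states, for every set of Bethe roots attached to an eigenvalue
    (∀ (M : Fin (p.n + 1)) (u : Fin p.n → ℂ), p.IsRootSetPlus M u →
      v M = (p.normStar π vs u * (p.trans v vs)⁻¹ (Fin.last p.n) M) •
        p.betheState π 1 αp m₀ (vs 0) u) ∧
    (∀ (N : Fin (p.n + 1)) (w : Fin p.n → ℂ), p.IsRootSetMinus N w →
      vs N = (p.norm π v w * p.trans v vs (Fin.last p.n) N) •
        p.betheState π (-1) αm m₀ (v 0) w) ∧
    -- every solution of the Bethe equations gives an eigenvector, and its eigenvalue by the formula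
    (∀ u : Fin p.n → ℂ, p.IsBetheSolution 1 u →
      π p.A (p.betheState π 1 αp m₀ (vs 0) u)
          = p.θofRoots u • p.betheState π 1 αp m₀ (vs 0) u ∧
        ∃ M : Fin (p.n + 1), p.IsRootSetPlus M u) ∧
    (∀ w : Fin p.n → ℂ, p.IsBetheSolution (-1) w →
      π p.As (p.betheState π (-1) αm m₀ (v 0) w)
          = p.θsOfRoots w • p.betheState π (-1) αm m₀ (v 0) w ∧
        ∃ N : Fin (p.n + 1), p.IsRootSetMinus N w) ∧
    -- in particular, if Bethe roots exist for all eigenvalues, all eigenvectors are Bethe states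
    (p.BetheRootsExist →
      (∀ M : Fin (p.n + 1), ∃ u : Fin p.n → ℂ, p.IsRootSetPlus M u ∧
        v M = (p.normStar π vs u * (p.trans v vs)⁻¹ (Fin.last p.n) M) •
          p.betheState π 1 αp m₀ (vs 0) u) ∧
      (∀ N : Fin (p.n + 1), ∃ w : Fin p.n → ℂ, p.IsRootSetMinus N w ∧
        vs N = (p.norm π v w * p.trans v vs (Fin.last p.n) N) •
          p.betheState π (-1) αm m₀ (v 0) w)) := by
  have h : p.IsLeonardRep (π p.A) (π p.As) v vs :=
    { r_ne := hr
      q_pow_ne := hq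
      ζ_ne := hζ
      b_ne := hb
      c_ne := hc
      bs_ne := hbs
      cs_ne := hcs
      bc_eq := hρ
      aw1 := AWBethe.Params.rep_aw1 π
      aw2 := AWBethe.Params.rep_aw2 π
      irr := fun W hA hB => hirr W (AWBethe.Params.rep_mem π W hA hB)
      eig := hv
      eigs := hvs
      θ_inj := hθ
      θs_inj := hθs }
  -- Hence (P⁻¹)_{n,M} is the last coordinate of |θ_M⟩ in the eigenbasis of A*, the quantity that
  -- normalizes `eigenvector_eq`.
  have hPinv : (p.trans v vs)⁻¹ = vs.toMatrix v :=
    Matrix.inv_eq_left_inv (vs.toMatrix_mul_toMatrix_flip v)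
  have hplus : ∀ u : Fin p.n → ℂ, _ := fun u =>
    AWBethe.Params.betheState_eq π (m₀ := m₀) (α := αp) (vs 0) (u := u) _
      (fun i => AWBethe.Params.map_dynB_plus π αp (u i) _)
  have hminus : ∀ w : Fin p.n → ℂ, _ := fun w =>
    AWBethe.Params.betheState_eq π (m₀ := m₀) (α := αm) (v 0) (u := w) _
      (fun i => AWBethe.Params.map_dynB_minus π αm (w i) _)
  -- The sign (-1)^n from X → -X compensates the one in `norm_mul`.
  have hsw : ∀ w : Fin p.n → ℂ,
      Polynomial.aeval (p.swap.opX (π p.As) (π p.A))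
        (p.swap.rootPoly Finset.univ fun i => (w i)⁻¹) (v 0) =
      (-1 : ℂ) ^ p.n • Polynomial.aeval (p.opX (π p.A) (π p.As))
        (p.rootPoly Finset.univ w) (v 0) := fun w => by
    rw [h.opX_swap, AWBethe.Params.aeval_swap_rootPoly, LinearMap.smul_apply]
  have hsq : (-1 : ℂ) ^ p.n * (-1) ^ p.n = 1 := by rw [← mul_pow]; simp
  have part1 : ∀ (M : Fin (p.n + 1)) (u : Fin p.n → ℂ), p.IsRootSetPlus M u →
      v M = (p.normStar π vs u * (p.trans v vs)⁻¹ (Fin.last p.n) M) •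
        p.betheState π 1 αp m₀ (vs 0) u := by
    rintro M u ⟨hu, hM⟩
    rw [hplus, smul_smul, mul_right_comm, h.normStar_mul hχ hαp hu, hPinv]
    exact h.eigenvector_eq hu hM
  have part2 : ∀ (N : Fin (p.n + 1)) (w : Fin p.n → ℂ), p.IsRootSetMinus N w →
      vs N = (p.norm π v w * p.trans v vs (Fin.last p.n) N) •
        p.betheState π (-1) αm m₀ (v 0) w := by
    rintro N w ⟨hw, hN⟩
    rw [hminus, smul_smul, mul_right_comm, h.norm_mul hχ hαm hw]
    have h1 := h.swap.eigenvector_eq (p.swap_isBetheSolution h.q_ne hζ hw) (M := N)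
      (by rw [AWBethe.Params.swap_θ, AWBethe.Params.swap_θofRoots, hN])
    refine h1.trans ?_
    refine (congrArg _ (hsw w)).trans ?_
    rw [smul_smul]
    congr 1
    rw [mul_right_comm, mul_comm ((-1 : ℂ) ^ p.n)]
    rfl
  have part4 : ∀ w : Fin p.n → ℂ, p.IsBetheSolution (-1) w →
      π p.As (p.betheState π (-1) αm m₀ (v 0) w)
          = p.θsOfRoots w • p.betheState π (-1) αm m₀ (v 0) w ∧
        ∃ N : Fin (p.n + 1), p.IsRootSetMinus N w := by
    intro w hw
    have hw' := p.swap_isBetheSolution h.q_ne hζ hw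
    constructor
    · have h1 := h.swap.A_bethe hw'
      rw [AWBethe.Params.swap_θofRoots] at h1
      have h2 := hsw w
      have h3 : Polynomial.aeval (p.opX (π p.A) (π p.As)) (p.rootPoly Finset.univ w) (v 0) =
          (-1 : ℂ) ^ p.n • Polynomial.aeval (p.swap.opX (π p.As) (π p.A))
            (p.swap.rootPoly Finset.univ fun i => (w i)⁻¹) (v 0) := by
        rw [h2, smul_smul, hsq, one_smul]
      rw [hminus, h3, map_smul, map_smul, smul_comm (p.θsOfRoots w), smul_comm (p.θsOfRoots w)]
      exact congrArg _ (congrArg _ h1)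
    · obtain ⟨N, hN⟩ := h.swap.exists_θ_eq hw'
      rw [AWBethe.Params.swap_θ, AWBethe.Params.swap_θofRoots] at hN
      exact ⟨N, hw, hN⟩
  refine ⟨part1, part2, fun u hu => ⟨?_, ?_⟩, part4, fun hex => ⟨fun M => ?_, fun N => ?_⟩⟩
  · rw [hplus, map_smul, h.A_bethe hu, smul_comm]
  · obtain ⟨M, hM⟩ := h.exists_θ_eq hu
    exact ⟨M, hu, hM⟩
  · obtain ⟨u, hu⟩ := hex.1 M
    exact ⟨u, hu, part1 M u hu⟩
  · obtain ⟨w, hw⟩ := hex.2 N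
    exact ⟨w, hw, part2 N w hw⟩
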